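/- Let $(\Omega,\mathcal F,\mathbb P;(\mathcal F_t)_{t=0}^T)$ be a filtered probability space with $\Omega$ finite, $\mathcal F_0=\{\emptyset,\Omega\}$, $\mathcal F_T=\mathcal F=2^\Omega$ and $\mathbb P(\{\omega\})>0$ for all $\omega$; let $\mathcal L_t$ be the set of $\mathcal F_t$-measurable $\mathbb R^d$-valued random variables. There are $d$ assets, with $\mathcal F_t$-measurable exchange rates $\pi^{jk}_t>0$, $\pi^{jj}_t=1$: at time $t$, one unit of asset $k$ is obtained for $\pi^{jk}_t$ units of asset $j$. The solvency cone $\mathcal K_t$ is the set of $x\in\mathcal L_t$ for which there are $\mathcal F_t$-measurable $\beta^{jk}\ge 0$ such that $x^k+\sum_j\beta^{jk}-\sum_j\beta^{kj}\pi^{kj}_t\ge0$ for all $k$; $\mathcal K_t^\ast$ is the (nodewise) dual cone $\{y : y\cdot x\ge 0\ \text{for all } x\in\mathcal K_t\}$. A trading strategy is a process $y=(y_t)_{t=0}^{T+1}$ with $y_0\in\mathbb R^d$, $y_{t+1}\in\mathcal L_t$ for $t=0,\dots,T$, and $y_{T+1}=0$; $\Phi$ is the set of trading strategies. Assume that there is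 no arbitrage: there are no $y\in\Phi$ and no $x\in\mathcal L_T\setminus\{0\}$ with non-negative holdings in all assets such that $y_0=0$, $y_t-y_{t+1}\in\mathcal K_t$ for all $t=0,\dots,T-1$, and $y_T-x\in\mathcal K_T$. A mixed stopping time is an adapted $[0,1]$-valued process $\chi=(\chi_t)_{t=0}^T$ with $\sum_{t=0}^T\chi_t=1$; let $\mathcal X$ be the set of mixed stopping times, and for an adapted process $X$ put $X_\chi=\sum_{t=0}^T\chi_tX_t$. Let $\xi=(\xi_t)_{t=0}^T$ be an $\mathbb R^d$-valued adapted process, the payoff of an American option. Let $e^j$ be the $j$-th vector of the canonical basis of $\mathbb R^d$. The bid price of $\xi$ in currency $j$ under gradual exercise is \[ \pi^{\mathrm{bg}}_j(\xi)=\sup\{-x\in\mathbb R : \exists\, y\in\Phi,\ \chi\in\mathcal X \text{ with } y_0=xe^j \text{ and } y_t+\chi_t\xi_t-y_{t+1}\in\mathcal K_t \text{ for all } t=0,\dots,T\}. \] Let $\bar{\mathcal P}_j$ be the set of pairs $(\mathbb Q,S)$ such that $\mathbb Q$ is a probability measure absolutely continuous with respect to $\mathbb P$, $S=(S_t)_{t=0}^T$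 is an $\mathbb R^d$-valued $\mathbb Q$-martingale, $S_t\in\mathcal K^\ast_t\setminus\{0\}$ (at every node) and $S^j_t=1$ for all $t=0,\dots,T$. **Theorem.** For every $j=1,\dots,d$ the bid price $\pi^{\mathrm{bg}}_j(\xi)$ is finite, and \[ \pi^{\mathrm{bg}}_j(\xi)=\max_{\chi\in\mathcal X}\ \min_{(\mathbb Q,S)\in\bar{\mathcal P}_j}\mathbb E_{\mathbb Q}\big((\xi\cdot S)_\chi\big), \] where the minimum is attained for every $\chi\in\mathcal X$ and the maximum is attained. Moreover, one can algorithmically construct $\hat\chi\in\mathcal X$ and $(\hat{\mathbb Q},\hat S)\in\bar{\mathcal P}_j$ such that \[ \pi^{\mathrm{bg}}_j(\xi)=\mathbb E_{\hat{\mathbb Q}}\big((\xi\cdot\hat S)_{\hat\chi}\big)=\min_{(\mathbb Q,S)\in\bar{\mathcal P}_j}\mathbb E_{\mathbb Q}\big((\xi\cdot S)_{\hat\chi}\big). \] Here this means: for every fixed $(\Omega,(\mathcal F_t)_{t=0}^T)$, $d$ and $j$ there is a finite program in exact real arithmetic (an algebraic computation tree with rational constants, the operations $+,-,\times,\div$ and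 comparisons) which, for all arbitrage-free exchange rates and all adapted payoffs, takes the values $\pi^{ik}_t(\omega)$, $\xi^k_t(\omega)$ as its inputs and outputs the values $\hat\chi_t(\omega)$, $\hat{\mathbb Q}(\{\omega\})$, $\hat S^k_t(\omega)$ of such $\hat\chi$, $\hat{\mathbb Q}$, $\hat S$. -/

import Mathlib

open MeasureTheory

noncomputable section

namespace GradualExercise

/-! ### The market

`Ω` is a finite sample space with a filtration `ℱ` indexed by the dates `0, …, T`; there are `d`
assets, and `rate t j k ω` is the number of units of asset `j` which have to be given up at date `t`
in state `ω` in order to obtain one unit of asset `k`. -/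

section Market

variable {Ω : Type*} [mΩ : MeasurableSpace Ω] {T d : ℕ}

/-- The exchange rates are positive and adapted, and an asset trades one to one against itself. -/
structure IsExchangeRates (ℱ : Filtration (Fin (T + 1)) mΩ)
    (rate : Fin (T + 1) → Fin d → Fin d → Ω → ℝ) : Prop where
  pos : ∀ t j k ω, 0 < rate t j k ω
  self : ∀ t j ω, rate t j j ω = 1
  measurable : ∀ t j k, Measurable[ℱ t] (rate t j k)

/-- The portfolio `x` can be exchanged into the portfolio `y` at date `t`; `β j k` is the number of
units of asset `k` that are received by exchanging units of asset `j`. -/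
def CanExchange (ℱ : Filtration (Fin (T + 1)) mΩ) (rate : Fin (T + 1) → Fin d → Fin d → Ω → ℝ)
    (t : Fin (T + 1)) (x y : Ω → Fin d → ℝ) : Prop :=
  ∃ β : Fin d → Fin d → Ω → ℝ,
    (∀ j k, Measurable[ℱ t] (β j k)) ∧ (∀ j k ω, 0 ≤ β j k ω) ∧
    ∀ ω k, y ω k = x ω k + ∑ j, β j k ω - ∑ j, β k j ω * rate t k j ω

/-- The solvency cone `K_t`: the `ℱ t`-measurable portfolios that can be exchanged into
portfolios with non-negative holdings in all assets. -/
def solvencyCone (ℱ : Filtration (Fin (T + 1)) mΩ) (rate : Fin (T + 1) → Fin d → Fin d → Ω → ℝ)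
    (t : Fin (T + 1)) : Set (Ω → Fin d → ℝ) :=
  {x | Measurable[ℱ t] x ∧
    ∃ y : Ω → Fin d → ℝ, Measurable[ℱ t] y ∧ (∀ ω k, 0 ≤ y ω k) ∧ CanExchange ℱ rate t x y}

/-- The values at `ω` of a set of random portfolios (for the solvency cone at date `t`: the cone at
the node of date `t` which contains `ω`). -/
def nodeSet (A : Set (Ω → Fin d → ℝ)) (ω : Ω) : Set (Fin d → ℝ) :=
  (fun x => x ω) '' A

/-- `A* = {y | y · x ≥ 0 for all x ∈ A}`, the polar of `-A`. -/
def dualCone (A : Set (Fin d → ℝ)) : Set (Fin d → ℝ) :=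
  {y | ∀ x ∈ A, 0 ≤ y ⬝ᵥ x}

/-- Trading strategies: `y 0` is the deterministic initial endowment, `y (t + 1)` is chosen at
date `t` (so the strategy is predictable), and the final value `y (T + 1)` is zero. -/
def tradingStrategies (ℱ : Filtration (Fin (T + 1)) mΩ) (d : ℕ) :
    Set (Fin (T + 2) → Ω → Fin d → ℝ) :=
  {y | (∃ x₀ : Fin d → ℝ, ∀ ω, y 0 ω = x₀) ∧
    (∀ t : Fin (T + 1), Measurable[ℱ t] (y t.succ)) ∧
    ∀ ω, y (Fin.last (T + 1)) ω = 0}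

/-- A strategy is self-financing if `y_t - y_{t+1} ∈ K_t` for all `t = 0, …, T - 1`. -/
def IsSelfFinancing (ℱ : Filtration (Fin (T + 1)) mΩ)
    (rate : Fin (T + 1) → Fin d → Fin d → Ω → ℝ) (y : Fin (T + 2) → Ω → Fin d → ℝ) : Prop :=
  ∀ t : Fin (T + 1), t ≠ Fin.last T → y t.castSucc - y t.succ ∈ solvencyCone ℱ rate t

/-- There is no self-financing strategy with zero initial endowment whose value at date `T` can be
exchanged into a non-zero portfolio with non-negative holdings (and possibly a solvent rest). -/
def NoArbitrage (ℱ : Filtration (Fin (T + 1)) mΩ)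
    (rate : Fin (T + 1) → Fin d → Fin d → Ω → ℝ) : Prop :=
  ¬ ∃ y ∈ tradingStrategies ℱ d, IsSelfFinancing ℱ rate y ∧ (∀ ω, y 0 ω = 0) ∧
    ∃ x : Ω → Fin d → ℝ, Measurable[ℱ (Fin.last T)] x ∧ x ≠ 0 ∧ (∀ ω k, 0 ≤ x ω k) ∧
      y (Fin.last T).castSucc - x ∈ solvencyCone ℱ rate (Fin.last T)

/-! ### Gradual exercise -/

/-- Mixed stopping times: adapted `[0,1]`-valued processes which sum up to one over time. -/
def mixedStoppingTimes (ℱ : Filtration (Fin (T + 1)) mΩ) : Set (Fin (T + 1) → Ω → ℝ) :=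
  {χ | (∀ t, Measurable[ℱ t] (χ t)) ∧ (∀ t ω, χ t ω ∈ Set.Icc (0 : ℝ) 1) ∧
    ∀ ω, ∑ t, χ t ω = 1}

/-- The process `X` evaluated at the mixed stopping time `χ`: `X_χ = ∑ χ_t X_t`. -/
def evalAt (χ X : Fin (T + 1) → Ω → ℝ) (ω : Ω) : ℝ :=
  ∑ t, χ t ω * X t ω

/-- The superhedging strategies `(y, χ)` of the buyer of the American option with payoff process
`ξ` under gradual exercise: `y_t + χ_t ξ_t - y_{t+1} ∈ K_t` for all `t = 0, …, T`. -/
def buyerStrategies (ℱ : Filtration (Fin (T + 1)) mΩ)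
    (rate : Fin (T + 1) → Fin d → Fin d → Ω → ℝ) (ξ : Fin (T + 1) → Ω → Fin d → ℝ) :
    Set ((Fin (T + 2) → Ω → Fin d → ℝ) × (Fin (T + 1) → Ω → ℝ)) :=
  {p | p.1 ∈ tradingStrategies ℱ d ∧ p.2 ∈ mixedStoppingTimes ℱ ∧
    ∀ t : Fin (T + 1),
      (fun ω => p.1 t.castSucc ω + p.2 t ω • ξ t ω - p.1 t.succ ω) ∈ solvencyCone ℱ rate t}

/-- The bid price in currency `j`: the supremum (in the extended reals) of all `-x` such that some
buyer's superhedging strategy starts from `x` units of currency `j`. -/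
def bidPrice (ℱ : Filtration (Fin (T + 1)) mΩ)
    (rate : Fin (T + 1) → Fin d → Fin d → Ω → ℝ) (ξ : Fin (T + 1) → Ω → Fin d → ℝ)
    (j : Fin d) : EReal :=
  sSup {r | ∃ x : ℝ, r = ((-x : ℝ) : EReal) ∧
    ∃ p ∈ buyerStrategies ℱ rate ξ, ∀ ω, p.1 0 ω = x • (Pi.single j 1 : Fin d → ℝ)}

/-! ### Pricing pairs -/

/-- Pairs `(Q, S)` of a probability measure `Q`, absolutely continuous with respect to `P`, and a
`Q`-martingale `S` with `S_t ∈ K_t* \ {0}` for all `t` (at every node). -/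
def pricingPairs (P : Measure Ω) (ℱ : Filtration (Fin (T + 1)) mΩ)
    (rate : Fin (T + 1) → Fin d → Fin d → Ω → ℝ) :
    Set (Measure Ω × (Fin (T + 1) → Ω → Fin d → ℝ)) :=
  {q | IsProbabilityMeasure q.1 ∧ q.1 ≪ P ∧ Martingale q.2 ℱ q.1 ∧
    ∀ t ω, q.2 t ω ∈ dualCone (nodeSet (solvencyCone ℱ rate t) ω) \ {0}}

/-- The pricing pairs with `S^j = 1`. -/
def pricingPairsIn (P : Measure Ω) (ℱ : Filtration (Fin (T + 1)) mΩ)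
    (rate : Fin (T + 1) → Fin d → Fin d → Ω → ℝ) (j : Fin d) :
    Set (Measure Ω × (Fin (T + 1) → Ω → Fin d → ℝ)) :=
  {q | q ∈ pricingPairs P ℱ rate ∧ ∀ t ω, q.2 t ω j = 1}

/-- The expectation under `Q` of `(ξ · S)_χ`. -/
def expectedPayoff (ξ : Fin (T + 1) → Ω → Fin d → ℝ) (χ : Fin (T + 1) → Ω → ℝ)
    (q : Measure Ω × (Fin (T + 1) → Ω → Fin d → ℝ)) : ℝ :=
  ∫ ω, evalAt χ (fun t ω' => ξ t ω' ⬝ᵥ q.2 t ω') ω ∂q.1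

end Market

/-! ### Exact real arithmetic algorithms

Algorithms on finitely many real numbers are algebraic computation trees: finite programs that use
rational constants, the four arithmetic operations and comparisons. -/

section Algorithms

/-- Arithmetic expressions in the inputs indexed by `ι`, with rational constants. -/
inductive ArithExpr (ι : Type*)
  | input (i : ι) : ArithExpr ι
  | const (c : ℚ) : ArithExpr ι
  | add (a b : ArithExpr ι) : ArithExpr ι
  | sub (a b : ArithExpr ι) : ArithExpr ι
  | mul (a b : ArithExpr ι) : ArithExpr ι
  | div (a b : ArithExpr ι) : ArithExpr ι

/-- The value of an expression (a division by zero, which a program can avoid by a test, gives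
zero). -/
def ArithExpr.eval {ι : Type*} (v : ι → ℝ) : ArithExpr ι → ℝ
  | .input i => v i
  | .const c => (c : ℝ)
  | .add a b => a.eval v + b.eval v
  | .sub a b => a.eval v - b.eval v
  | .mul a b => a.eval v * b.eval v
  | .div a b => a.eval v / b.eval v

/-- Finite programs with inputs indexed by `ι` and outputs indexed by `κ`. -/
inductive RealAlgorithm (ι κ : Type*)
  | output (e : κ → ArithExpr ι) : RealAlgorithm ι κ
  | test (e : ArithExpr ι) (ifNonneg ifNeg : RealAlgorithm ι κ) : RealAlgorithm ι κ

open Classical in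
/-- The outputs of a program run on the inputs `v`. -/
def RealAlgorithm.run {ι κ : Type*} (v : ι → ℝ) : RealAlgorithm ι κ → κ → ℝ
  | .output e => fun k => (e k).eval v
  | .test e ifNonneg ifNeg => if 0 ≤ e.eval v then ifNonneg.run v else ifNeg.run v

/-- Indices of the input data: the exchange rates and the payoffs. -/
abbrev InputIndex (Ω : Type*) (T d : ℕ) :=
  (Fin (T + 1) × Fin d × Fin d × Ω) ⊕ (Fin (T + 1) × Fin d × Ω)

/-- Indices of the output data: a mixed stopping time, the weights of a probability measure, and an
`ℝ^d`-valued process. -/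
abbrev OutputIndex (Ω : Type*) (T d : ℕ) :=
  (Fin (T + 1) × Ω) ⊕ Ω ⊕ (Fin (T + 1) × Fin d × Ω)

variable {Ω : Type*} [MeasurableSpace Ω] {T d : ℕ}

/-- The numerical data of a market and an option, as inputs of an algorithm. -/
def encodeInput (rate : Fin (T + 1) → Fin d → Fin d → Ω → ℝ)
    (ξ : Fin (T + 1) → Ω → Fin d → ℝ) : InputIndex Ω T d → ℝ
  | .inl (t, j, k, ω) => rate t j k ω
  | .inr (t, k, ω) => ξ t ω k

/-- The numbers which describe a mixed stopping time, a probability measure and a price process. -/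
def encodeOutput (χ : Fin (T + 1) → Ω → ℝ)
    (q : Measure Ω × (Fin (T + 1) → Ω → Fin d → ℝ)) : OutputIndex Ω T d → ℝ
  | .inl (t, ω) => χ t ω
  | .inr (.inl ω) => q.1.real {ω}
  | .inr (.inr (t, k, ω)) => q.2 t ω k

end Algorithms

end GradualExercise

end

open GradualExercise

/-!
The theorem is a statement of linear programming duality. For a pricing pair `(Q, S)` put
`Z ω = Q {ω} • S_T ω`. By the martingale property the sum of `Z` over a node of date `t` is the
weight of the node times `S_t`, so that these `Z` are, up to the choice of `S` at nodes of weight zero,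
the points of a polytope: the node sums lie in the duals of the solvency cones, which are given by
finitely many linear inequalities, and the `j`-th coordinates of `Z` sum to one. Moreover
`E_Q ((ξ · S)_χ) = ∑ ω, Z ω ⬝ᵥ (∑ t, χ_t ω • ξ_t ω)` is bilinear in `χ` and `Z`
(`image_expectedPayoff`).

On the other side, `x` units of asset `j` and the mixed stopping time `χ` superhedge the buyer's
position if and only if the endowment plus the mixed payoff is a sum of solvent portfolios, one for
each date (`exists_buyerStrategy_iff`). These sums form a finitely generated cone, whose dual
consists of the weighted prices `Z`. Farkas' lemma (`mem_cone_of_forall_nonneg`) therefore shows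
that `χ` superhedges from `x` if and only if `-x` is at most the minimum over the polytope of the
value of the mixed payoff (`exists_buyerStrategy_iff_forall_le`), and the bid price is the maximum
over `χ` of these minima. The minimum is attained by compactness; it depends continuously on `χ`,
so that the maximum is attained as well. The absence of arbitrage enters through Farkas' lemma as
well: it yields weighted prices which are positive in all states
(`NoArbitrage.exists_weightedPrices_pos`), which make the polytope non-empty and provide `S` at the
nodes of weight zero.

For the algorithm, an optimal `χ` solves one linear program (its unknowns are the endowment, `χ`
and the coefficients of the generators of the solvency cones), an optimal `Z` against this `χ`
solves a second one, and positive weighted prices solve a third one. A maximiser of a linear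
program whose coefficients are computable from the input is computable
(`IsParamPolyhedron.exists_computable_maximizer`), by induction on the number of unknowns: an
optimal point can be moved along the first unknown until this unknown vanishes or some constraint
that involves it is tight. Either condition eliminates the unknown, and the best feasible one among
the finitely many resulting candidates is optimal.
-/

open GradualExercise

namespace GradualExercise

/-! ### Computable functions -/

section Computable

variable {ι κ μ : Type*}

/-- Run a program and pass the expressions for its outputs to a continuation. -/
def RealAlgorithm.bind : RealAlgorithm ι κ → ((κ → ArithExpr ι) → RealAlgorithm ι μ) →
    RealAlgorithm ι μ
  | .output e, F => F e
  | .test e A B, F => .test e (A.bind F) (B.bind F)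

/-- On fixed inputs a program follows one branch, so that composing it with a continuation amounts
to running the continuation on the output expressions of that branch. -/
lemma RealAlgorithm.exists_run_bind (A : RealAlgorithm ι κ)
    (F : (κ → ArithExpr ι) → RealAlgorithm ι μ) (v : ι → ℝ) :
    ∃ e : κ → ArithExpr ι, (∀ k, A.run v k = (e k).eval v) ∧ (A.bind F).run v = (F e).run v := by
  induction A with
  | output e => exact ⟨e, fun _ => rfl, rfl⟩
  | test e A B hA hB =>
    by_cases h : 0 ≤ e.eval v
    · simpa [RealAlgorithm.bind, RealAlgorithm.run, h] using hA
    · simpa [RealAlgorithm.bind, RealAlgorithm.run, h] using hB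

/-- The real functions of finitely many real numbers which are computed by some program. -/
def IsComputable (f : (ι → ℝ) → ℝ) : Prop :=
  ∃ A : RealAlgorithm ι Unit, ∀ v, A.run v () = f v

lemma isComputable_input (i : ι) : IsComputable fun v => v i :=
  ⟨.output fun _ => .input i, fun _ => rfl⟩

lemma isComputable_ratCast (c : ℚ) : IsComputable fun _ : ι → ℝ => (c : ℝ) :=
  ⟨.output fun _ => .const c, fun _ => rfl⟩

lemma isComputable_zero : IsComputable fun _ : ι → ℝ => (0 : ℝ) := by
  simpa using isComputable_ratCast (ι := ι) 0

lemma isComputable_one : IsComputable fun _ : ι → ℝ => (1 : ℝ) := by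
  simpa using isComputable_ratCast (ι := ι) 1

namespace IsComputable

lemma map₂ {f g : (ι → ℝ) → ℝ} (hf : IsComputable f) (hg : IsComputable g)
    (c : ArithExpr ι → ArithExpr ι → ArithExpr ι) (op : ℝ → ℝ → ℝ)
    (hc : ∀ a b v, (c a b).eval v = op (a.eval v) (b.eval v)) :
    IsComputable fun v => op (f v) (g v) := by
  obtain ⟨A, hA⟩ := hf
  obtain ⟨B, hB⟩ := hg
  refine ⟨A.bind fun a => B.bind fun b => .output fun _ => c (a ()) (b ()), fun v => ?_⟩
  obtain ⟨a, ha, h⟩ := A.exists_run_bind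
    (fun a => B.bind fun b => .output fun _ : Unit => c (a ()) (b ())) v
  obtain ⟨b, hb, h'⟩ := B.exists_run_bind (fun b => .output fun _ : Unit => c (a ()) (b ())) v
  rw [h, h']
  simp only [RealAlgorithm.run, hc, ← ha, ← hb, hA, hB]

lemma add {f g : (ι → ℝ) → ℝ} (hf : IsComputable f) (hg : IsComputable g) :
    IsComputable fun v => f v + g v := hf.map₂ hg .add _ fun _ _ _ => rfl

lemma sub {f g : (ι → ℝ) → ℝ} (hf : IsComputable f) (hg : IsComputable g) :
    IsComputable fun v => f v - g v := hf.map₂ hg .sub _ fun _ _ _ => rfl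

lemma mul {f g : (ι → ℝ) → ℝ} (hf : IsComputable f) (hg : IsComputable g) :
    IsComputable fun v => f v * g v := hf.map₂ hg .mul _ fun _ _ _ => rfl

lemma div {f g : (ι → ℝ) → ℝ} (hf : IsComputable f) (hg : IsComputable g) :
    IsComputable fun v => f v / g v := hf.map₂ hg .div _ fun _ _ _ => rfl

lemma neg {f : (ι → ℝ) → ℝ} (hf : IsComputable f) : IsComputable fun v => - f v := by
  simpa using isComputable_zero.sub hf

lemma sum {f : κ → (ι → ℝ) → ℝ} (s : Finset κ) (hf : ∀ k, IsComputable (f k)) :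
    IsComputable fun v => ∑ k ∈ s, f k v := by
  classical
  induction s using Finset.induction_on with
  | empty => simpa using isComputable_zero
  | insert a s ha ih => simpa [Finset.sum_insert ha] using (hf a).add ih

open Classical in
lemma ite {p : (ι → ℝ) → Prop} {t f g : (ι → ℝ) → ℝ} (ht : IsComputable t)
    (hp : ∀ v, p v ↔ 0 ≤ t v) (hf : IsComputable f) (hg : IsComputable g) :
    IsComputable fun v => if p v then f v else g v := by
  obtain ⟨C, hC⟩ := ht
  obtain ⟨A, hA⟩ := hf
  obtain ⟨B, hB⟩ := hg
  refine ⟨C.bind fun c => .test (c ()) A B, fun v => ?_⟩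
  obtain ⟨c, hc, h⟩ := C.exists_run_bind (fun c => .test (c ()) A B) v
  rw [h, RealAlgorithm.run, ← hc, hC]
  by_cases h0 : 0 ≤ t v <;> simp [hp, h0, hA, hB]

lemma const_ite {f g : (ι → ℝ) → ℝ} (p : Prop) {_ : Decidable p} (hf : IsComputable f)
    (hg : IsComputable g) : IsComputable fun v => if p then f v else g v := by
  split_ifs <;> assumption

end IsComputable

/-- A finite family of computable functions is computed by a single program. -/
theorem exists_algorithm [Finite κ] (f : (ι → ℝ) → κ → ℝ)
    (hf : ∀ k, IsComputable fun v => f v k) :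
    ∃ A : RealAlgorithm ι κ, ∀ v, A.run v = f v := by
  classical
  cases nonempty_fintype κ
  suffices H : ∀ s : Finset κ, ∃ A : RealAlgorithm ι κ, ∀ v, ∀ k ∈ s, A.run v k = f v k by
    obtain ⟨A, hA⟩ := H Finset.univ
    exact ⟨A, fun v => funext fun k => hA v k (Finset.mem_univ k)⟩
  intro s
  induction s using Finset.induction_on with
  | empty => exact ⟨.output fun _ => .const 0, by simp⟩
  | insert k s _ ih =>
    obtain ⟨A, hA⟩ := ih
    obtain ⟨B, hB⟩ := hf k
    refine ⟨A.bind fun a => B.bind fun b => .output (Function.update a k (b ())), fun v l hl => ?_⟩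
    obtain ⟨a, ha, h⟩ := A.exists_run_bind
      (fun a => B.bind fun b => .output (Function.update a k (b ()))) v
    obtain ⟨b, hb, h'⟩ := B.exists_run_bind (fun b => .output (Function.update a k (b ()))) v
    rw [h, h', RealAlgorithm.run]
    by_cases hlk : l = k
    · subst hlk
      simp [← hb, hB]
    · simp only [Function.update_of_ne hlk, ← ha]
      exact hA v l (by simpa [hlk] using hl)

/-- The conditions on real inputs which can be tested by a program. -/
def IsTestable (p : (ι → ℝ) → Prop) : Prop :=
  ∃ f : (ι → ℝ) → ℝ, IsComputable f ∧ ∀ v, p v ↔ 0 ≤ f v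

namespace IsTestable

lemma le {f g : (ι → ℝ) → ℝ} (hf : IsComputable f) (hg : IsComputable g) :
    IsTestable fun v => f v ≤ g v :=
  ⟨_, hg.sub hf, fun v => by simp⟩

open Classical in
lemma ite {p : (ι → ℝ) → Prop} {f g : (ι → ℝ) → ℝ} (hp : IsTestable p)
    (hf : IsComputable f) (hg : IsComputable g) :
    IsComputable fun v => if p v then f v else g v := by
  obtain ⟨t, ht, htp⟩ := hp
  exact ht.ite htp hf hg

lemma and {p q : (ι → ℝ) → Prop} (hp : IsTestable p) (hq : IsTestable q) :
    IsTestable fun v => p v ∧ q v := by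
  classical
  obtain ⟨g, hg, hgq⟩ := hq
  refine ⟨_, hp.ite hg isComputable_one.neg, fun v => ?_⟩
  by_cases h : p v <;> simp [h, hgq]

lemma imp {p q : (ι → ℝ) → Prop} (hp : IsTestable p) (hq : IsTestable q) :
    IsTestable fun v => p v → q v := by
  classical
  obtain ⟨g, hg, hgq⟩ := hq
  refine ⟨_, hp.ite hg isComputable_zero, fun v => ?_⟩
  by_cases h : p v <;> simp [h, hgq]

lemma ball {p : κ → (ι → ℝ) → Prop} {s : Set κ} (hs : s.Finite)
    (hp : ∀ k ∈ s, IsTestable (p k)) : IsTestable fun v => ∀ k ∈ s, p k v := by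
  induction s, hs using Set.Finite.induction_on with
  | empty => exact ⟨_, isComputable_zero, by simp⟩
  | insert _ _ ih =>
    simpa using (hp _ (Set.mem_insert _ _)).and (ih fun k hk => hp k (Set.mem_insert_of_mem _ hk))

end IsTestable

/-- A program can search through finitely many candidates for one which passes a test. -/
lemma exists_computable_choice [Finite κ] {p : κ → (ι → ℝ) → Prop} (hp : ∀ k, IsTestable (p k))
    {f : κ → (ι → ℝ) → μ → ℝ} (hf : ∀ k m, IsComputable fun v => f k v m) :
    ∃ x : (ι → ℝ) → μ → ℝ, (∀ m, IsComputable fun v => x v m) ∧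
      ∀ v, (∃ k, p k v) → ∃ k, p k v ∧ x v = f k v := by
  classical
  cases nonempty_fintype κ
  suffices H : ∀ s : Finset κ, ∃ x : (ι → ℝ) → μ → ℝ, (∀ m, IsComputable fun v => x v m) ∧
      ∀ v, (∃ k ∈ s, p k v) → ∃ k, p k v ∧ x v = f k v by
    obtain ⟨x, hx, h⟩ := H Finset.univ
    exact ⟨x, hx, fun v ⟨k, hk⟩ => h v ⟨k, Finset.mem_univ k, hk⟩⟩
  intro s
  induction s using Finset.induction_on with
  | empty => exact ⟨fun _ _ => 0, fun _ => isComputable_zero, by simp⟩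
  | insert k s _ ih =>
    obtain ⟨x, hx, h⟩ := ih
    refine ⟨fun v m => if p k v then f k v m else x v m, fun m => (hp k).ite (hf k m) (hx m),
      fun v hv => ?_⟩
    by_cases hk : p k v
    · exact ⟨k, hk, by simp [hk]⟩
    · obtain ⟨l, hl, hl'⟩ := h v (by simpa [hk] using hv)
      exact ⟨l, hl, by simpa [hk] using hl'⟩

end Computable

/-! ### Parametric linear programming -/

section LinearProgram

variable {ι J K : Type*} [Fintype J] [Fintype K]

/-- A family of affine functions of the unknowns `x`, whose coefficients are computable functions
of the parameters `v`. -/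
def IsParamAffine (L : (ι → ℝ) → (J → ℝ) → ℝ) : Prop :=
  ∃ (a : J → (ι → ℝ) → ℝ) (b : (ι → ℝ) → ℝ), (∀ j, IsComputable (a j)) ∧ IsComputable b ∧
    ∀ v x, L v x = ∑ j, a j v * x j + b v

lemma isParamAffine_unknown (j : J) : IsParamAffine fun (_ : ι → ℝ) (x : J → ℝ) => x j := by
  classical
  exact ⟨fun k _ => if k = j then 1 else 0, fun _ => 0,
    fun k => isComputable_one.const_ite _ isComputable_zero, isComputable_zero, by simp⟩

lemma IsComputable.isParamAffine {f : (ι → ℝ) → ℝ} (hf : IsComputable f) :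
    IsParamAffine fun v (_ : J → ℝ) => f v :=
  ⟨fun _ _ => 0, f, fun _ => isComputable_zero, hf, by simp⟩

namespace IsParamAffine

variable {L M : (ι → ℝ) → (J → ℝ) → ℝ}

lemma add (hL : IsParamAffine L) (hM : IsParamAffine M) :
    IsParamAffine fun v x => L v x + M v x := by
  obtain ⟨a, b, ha, hb, h⟩ := hL
  obtain ⟨a', b', ha', hb', h'⟩ := hM
  refine ⟨_, _, fun j => (ha j).add (ha' j), hb.add hb', fun v x => ?_⟩
  simp only [h, h', add_mul, Finset.sum_add_distrib]
  ring

lemma const_mul (hL : IsParamAffine L) {f : (ι → ℝ) → ℝ} (hf : IsComputable f) :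
    IsParamAffine fun v x => f v * L v x := by
  obtain ⟨a, b, ha, hb, h⟩ := hL
  refine ⟨_, _, fun j => hf.mul (ha j), hf.mul hb, fun v x => ?_⟩
  simp only [h, mul_add, Finset.mul_sum, mul_assoc]

lemma mul_const (hL : IsParamAffine L) {f : (ι → ℝ) → ℝ} (hf : IsComputable f) :
    IsParamAffine fun v x => L v x * f v := by
  simpa only [mul_comm] using hL.const_mul hf

lemma neg (hL : IsParamAffine L) : IsParamAffine fun v x => - L v x := by
  simpa using hL.const_mul isComputable_one.neg

lemma sub (hL : IsParamAffine L) (hM : IsParamAffine M) :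
    IsParamAffine fun v x => L v x - M v x := by
  simpa only [sub_eq_add_neg] using hL.add hM.neg

lemma sum {κ : Type*} {L : κ → (ι → ℝ) → (J → ℝ) → ℝ} (s : Finset κ)
    (hL : ∀ k, IsParamAffine (L k)) : IsParamAffine fun v x => ∑ k ∈ s, L k v x := by
  classical
  induction s using Finset.induction_on with
  | empty => simpa using isComputable_zero.isParamAffine
  | insert a s ha ih => simpa [Finset.sum_insert ha] using (hL a).add ih

lemma const_ite (p : Prop) {_ : Decidable p} (hL : IsParamAffine L) (hM : IsParamAffine M) :
    IsParamAffine fun v x => if p then L v x else M v x := by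
  split_ifs <;> assumption

/-- Affine functions remain affine after an affine substitution of the unknowns. -/
lemma comp (hL : IsParamAffine L) {σ : (ι → ℝ) → (K → ℝ) → J → ℝ}
    (hσ : ∀ j, IsParamAffine fun v x => σ v x j) : IsParamAffine fun v x => L v (σ v x) := by
  obtain ⟨a, b, ha, hb, h⟩ := hL
  simp only [h]
  exact (sum _ fun j => (hσ j).const_mul (ha j)).add hb.isParamAffine

/-- The values of a parametric affine function at computable points are computable. -/
lemma isComputable (hL : IsParamAffine L) {x : (ι → ℝ) → J → ℝ}
    (hx : ∀ j, IsComputable fun v => x v j) : IsComputable fun v => L v (x v) := by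
  obtain ⟨a, b, ha, hb, h⟩ := hL
  simp only [h]
  exact (IsComputable.sum _ fun j => (ha j).mul (hx j)).add hb

end IsParamAffine

/-- An optimal solution of a linear program in one unknown `s` can be moved to an optimal solution
which either vanishes or is a zero of a constraint that depends on `s`. -/
lemma exists_optimal_zero_or_tight {κ : Type*} {A : Set κ} (hA : A.Finite) (c r : κ → ℝ)
    (c₀ s₀ : ℝ) (hs₀ : ∀ k ∈ A, 0 ≤ c k * s₀ + r k)
    (hopt : ∀ s, (∀ k ∈ A, 0 ≤ c k * s + r k) → c₀ * s ≤ c₀ * s₀) :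
    ∃ s, (∀ k ∈ A, 0 ≤ c k * s + r k) ∧ c₀ * s = c₀ * s₀ ∧
      (s = 0 ∨ ∃ k ∈ A, c k ≠ 0 ∧ c k * s + r k = 0) := by
  -- the optimal solution which is closest to zero does the job
  have hclosed : IsClosed {s : ℝ | (∀ k ∈ A, 0 ≤ c k * s + r k) ∧ c₀ * s = c₀ * s₀} := by
    simp only [Set.ofPred_and, Set.ofPred_forall]
    refine (isClosed_iInter fun k => isClosed_iInter fun _ => ?_).inter ?_
    · exact isClosed_le continuous_const (by fun_prop)
    · exact isClosed_eq (by fun_prop) continuous_const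
  obtain ⟨s, ⟨hs, hs'⟩, hmin⟩ := hclosed.exists_infDist_eq_dist ⟨s₀, hs₀, rfl⟩ (0 : ℝ)
  refine ⟨s, hs, hs', ?_⟩
  by_contra! hcon
  obtain ⟨hne, hcon⟩ := hcon
  have hev : ∀ᶠ t in nhds s, ∀ k ∈ A, 0 ≤ c k * t + r k := by
    rw [hA.eventually_all]
    intro k hk
    by_cases hck : c k = 0
    · refine Filter.Eventually.of_forall fun t => ?_
      have := hs k hk
      simpa [hck] using this
    · have hpos : 0 < c k * s + r k := lt_of_le_of_ne (hs k hk) (Ne.symm (hcon k hk hck))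
      have hc : ContinuousAt (fun t => c k * t + r k) s := by fun_prop
      exact (hc.eventually (lt_mem_nhds hpos)).mono fun t ht => ht.le
  have hev' : ∀ᶠ ε in nhds (0 : ℝ), (∀ k ∈ A, 0 ≤ c k * (s - ε * s) + r k) ∧
      ∀ k ∈ A, 0 ≤ c k * (s + ε * s) + r k := by
    have h1 : Filter.Tendsto (fun ε : ℝ => s - ε * s) (nhds 0) (nhds s) := by
      have : Continuous fun ε : ℝ => s - ε * s := by fun_prop
      simpa using this.tendsto 0
    have h2 : Filter.Tendsto (fun ε : ℝ => s + ε * s) (nhds 0) (nhds s) := by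
      have : Continuous fun ε : ℝ => s + ε * s := by fun_prop
      simpa using this.tendsto 0
    exact (h1.eventually hev).and (h2.eventually hev)
  obtain ⟨ε, ⟨hε1, hε2⟩, hε0, hε3⟩ := ((hev'.filter_mono nhdsWithin_le_nhds).and
    (Ioo_mem_nhdsGT (zero_lt_one' ℝ))).exists
  have h1 := hopt _ hε1
  have h2 := hopt _ hε2
  -- both directions are feasible, so that the objective does not depend on `s`
  have h3 : c₀ * s = 0 := by
    have e1 : ε * (c₀ * s) ≤ 0 := by linarith
    have e2 : 0 ≤ ε * (c₀ * s) := by linarith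
    rcases mul_eq_zero.1 (le_antisymm e1 e2) with h | h
    · exact absurd h hε0.ne'
    · exact h
  have hle := Metric.infDist_le_dist_of_mem (x := (0 : ℝ))
    (show s - ε * s ∈ {s : ℝ | (∀ k ∈ A, 0 ≤ c k * s + r k) ∧ c₀ * s = c₀ * s₀} from
      ⟨hε1, by linear_combination hs' - ε * h3⟩)
  rw [hmin] at hle
  have e3 : s - ε * s = (1 - ε) * s := by ring
  simp only [dist_zero_left, e3, norm_mul, Real.norm_eq_abs] at hle
  rw [abs_of_pos (sub_pos.2 hε3)] at hle
  have := abs_pos.2 hne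
  nlinarith

/-- The induction step replaces the first unknown by `0`, or by the value which turns one of the
constraints into an equality; one of the resulting linear programs contains an optimal solution of
the given one. -/
lemma exists_computable_maximizer_fin (n : ℕ) (A : Set ((ι → ℝ) → (Fin n → ℝ) → ℝ))
    (hfin : A.Finite) (hA : ∀ L ∈ A, IsParamAffine L) (g : (ι → ℝ) → (Fin n → ℝ) → ℝ)
    (hg : IsParamAffine g) :
    ∃ x : (ι → ℝ) → Fin n → ℝ, (∀ i, IsComputable fun v => x v i) ∧
      ∀ v y, (∀ L ∈ A, 0 ≤ L v y) → (∀ z, (∀ L ∈ A, 0 ≤ L v z) → g v z ≤ g v y) →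
        (∀ L ∈ A, 0 ≤ L v (x v)) ∧ g v y ≤ g v (x v) := by
  classical
  induction n with
  | zero =>
    refine ⟨fun _ => Fin.elim0, fun i => i.elim0, fun v y hy _ => ?_⟩
    have : (Fin.elim0 : Fin 0 → ℝ) = y := Subsingleton.elim _ _
    rw [this]
    exact ⟨hy, le_rfl⟩
  | succ n ih =>
    have : Finite A := hfin
    have hcons : ∀ σ : (ι → ℝ) → (Fin n → ℝ) → ℝ, IsParamAffine σ →
        ∀ i, IsParamAffine fun v x => (Fin.cons (σ v x) x : Fin (n + 1) → ℝ) i := by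
      intro σ hσ i
      refine Fin.cases ?_ (fun i => ?_) i
      · simpa using hσ
      · simpa using isParamAffine_unknown i
    have hcons₀ : ∀ (f : (ι → ℝ) → ℝ), IsComputable f → ∀ i,
        IsComputable fun v => (Fin.cons (f v) 0 : Fin (n + 1) → ℝ) i := by
      intro f hf i
      refine Fin.cases ?_ (fun i => ?_) i
      · simpa using hf
      · simpa using isComputable_zero
    -- the coefficient of the first unknown
    let c : ((ι → ℝ) → (Fin (n + 1) → ℝ) → ℝ) → (ι → ℝ) → ℝ :=
      fun L v => L v (Fin.cons 1 0) - L v (Fin.cons 0 0)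
    have hc : ∀ L, IsParamAffine L → IsComputable (c L) := fun L hL =>
      (hL.isComputable (hcons₀ _ isComputable_one)).sub
        (hL.isComputable (hcons₀ _ isComputable_zero))
    have hsplit : ∀ L, IsParamAffine L → ∀ v (s : ℝ) (x : Fin n → ℝ),
        L v (Fin.cons s x) = c L v * s + L v (Fin.cons 0 x) := by
      rintro L ⟨a, b, -, -, h⟩ v s x
      simp [c, h, Fin.sum_univ_succ]
      ring
    let σ : Option A → (ι → ℝ) → (Fin n → ℝ) → ℝ := fun o v x =>
      o.elim 0 fun L => -(L.1 v (Fin.cons 0 x)) / c L.1 v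
    have hσ : ∀ o, IsParamAffine (σ o) := by
      rintro (_ | ⟨L, hL⟩)
      · exact isComputable_zero.isParamAffine
      · have h1 := ((hA L hL).comp (hcons _ isComputable_zero.isParamAffine)).neg
        simpa [σ, div_eq_mul_inv] using
          h1.mul_const (isComputable_one.div (hc L (hA L hL)))
    have hsub : ∀ o L, IsParamAffine L → IsParamAffine fun v x => L v (Fin.cons (σ o v x) x) :=
      fun o L hL => hL.comp (hcons _ (hσ o))
    have H := fun o => ih ((fun L v x => L v (Fin.cons (σ o v x) x)) '' A) (hfin.image _)
      (by rintro _ ⟨L, hL, rfl⟩; exact hsub o L (hA L hL)) _ (hsub o g hg)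
    simp only [Set.forall_mem_image] at H
    choose x hx hxopt using H
    let cand : Option A → (ι → ℝ) → Fin (n + 1) → ℝ := fun o v =>
      Fin.cons (σ o v (x o v)) (x o v)
    have hcand : ∀ o i, IsComputable fun v => cand o v i := by
      intro o i
      refine Fin.cases ?_ (fun i => ?_) i
      · simpa [cand] using (hσ o).isComputable (hx o)
      · simpa [cand] using hx o i
    have hfeas : ∀ o, IsTestable fun v => ∀ L ∈ A, 0 ≤ L v (cand o v) := fun o =>
      .ball hfin fun L hL => .le isComputable_zero ((hA L hL).isComputable (hcand o))
    have htest : ∀ o, IsTestable fun v => (∀ L ∈ A, 0 ≤ L v (cand o v)) ∧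
        ∀ o' ∈ Set.univ, (∀ L ∈ A, 0 ≤ L v (cand o' v)) → g v (cand o' v) ≤ g v (cand o v) :=
      fun o => (hfeas o).and (.ball Set.finite_univ fun o' _ => (hfeas o').imp
        (.le (hg.isComputable (hcand o')) (hg.isComputable (hcand o))))
    obtain ⟨w, hw, hwbest⟩ := exists_computable_choice htest hcand
    refine ⟨w, hw, fun v y hy hopt => ?_⟩
    -- some candidate is feasible and at least as good as `y`
    obtain ⟨o, ho, ho'⟩ : ∃ o, (∀ L ∈ A, 0 ≤ L v (cand o v)) ∧ g v y ≤ g v (cand o v) := by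
      obtain ⟨s₀, y', rfl⟩ : ∃ s y', y = Fin.cons s y' :=
        ⟨y 0, Fin.tail y, (Fin.cons_self_tail y).symm⟩
      obtain ⟨s, hs, hs', hst⟩ := exists_optimal_zero_or_tight hfin (fun L => c L v)
        (fun L => L v (Fin.cons 0 y')) (c g v) s₀
        (fun L hL => by simpa only [hsplit L (hA L hL) v s₀] using hy L hL)
        (fun s hs => by
          have := hopt (Fin.cons s y') fun L hL => by
            simpa only [hsplit L (hA L hL) v s] using hs L hL
          rw [hsplit g hg v s, hsplit g hg v s₀] at this
          linarith)
      obtain ⟨o, rfl⟩ : ∃ o, s = σ o v y' := by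
        rcases hst with rfl | ⟨L, hL, hcL, h⟩
        · exact ⟨none, rfl⟩
        · refine ⟨some ⟨L, hL⟩, ?_⟩
          simp only [σ, Option.elim]
          rw [eq_div_iff hcL]
          linarith
      have hgs : g v (Fin.cons (σ o v y') y') = g v (Fin.cons s₀ y') := by
        rw [hsplit g hg v s₀, hsplit g hg v (σ o v y'), hs']
      have := hxopt o v y'
        (fun L hL => by simpa only [hsplit L (hA L hL) v (σ o v y')] using hs L hL)
        (fun z hz => by rw [hgs]; exact hopt _ fun L hL => hz hL)
      exact ⟨o, fun L hL => this.1 hL, hgs ▸ this.2⟩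
    obtain ⟨ob, hob, hobmax⟩ := (Set.toFinite
      {o | ∀ L ∈ A, 0 ≤ L v (cand o v)}).exists_maximalFor (fun o => g v (cand o v)) _ ⟨o, ho⟩
    obtain ⟨k, ⟨hk, hkbest⟩, hwk⟩ := hwbest v ⟨ob, hob, fun o' _ ho' => by
      rcases le_total (g v (cand o' v)) (g v (cand ob v)) with h | h
      · exact h
      · exact hobmax ho' h⟩
    rw [hwk]
    exact ⟨hk, ho'.trans (hkbest o trivial ho)⟩

/-- A family of polyhedra in the space of the unknowns `x`, given by finitely many affine
inequalities with coefficients which are computable functions of the parameters `v`. -/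
def IsParamPolyhedron (p : (ι → ℝ) → (J → ℝ) → Prop) : Prop :=
  ∃ A : Set ((ι → ℝ) → (J → ℝ) → ℝ), A.Finite ∧ (∀ L ∈ A, IsParamAffine L) ∧
    ∀ v x, p v x ↔ ∀ L ∈ A, 0 ≤ L v x

namespace IsParamPolyhedron

lemma le {L M : (ι → ℝ) → (J → ℝ) → ℝ} (hL : IsParamAffine L) (hM : IsParamAffine M) :
    IsParamPolyhedron fun v x => L v x ≤ M v x :=
  ⟨{fun v x => M v x - L v x}, Set.finite_singleton _, by simpa using hM.sub hL, by simp⟩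

lemma and {p q : (ι → ℝ) → (J → ℝ) → Prop} (hp : IsParamPolyhedron p)
    (hq : IsParamPolyhedron q) : IsParamPolyhedron fun v x => p v x ∧ q v x := by
  obtain ⟨A, hA, hA', h⟩ := hp
  obtain ⟨B, hB, hB', h'⟩ := hq
  refine ⟨A ∪ B, hA.union hB, ?_, fun v x => ?_⟩
  · rintro L (hL | hL)
    exacts [hA' L hL, hB' L hL]
  · simp only [h, h', Set.mem_union, or_imp, forall_and]

lemma eq {L M : (ι → ℝ) → (J → ℝ) → ℝ} (hL : IsParamAffine L) (hM : IsParamAffine M) :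
    IsParamPolyhedron fun v x => L v x = M v x := by
  simpa only [le_antisymm_iff] using (le hL hM).and (le hM hL)

lemma all {κ : Type*} [Finite κ] {p : κ → (ι → ℝ) → (J → ℝ) → Prop}
    (hp : ∀ k, IsParamPolyhedron (p k)) : IsParamPolyhedron fun v x => ∀ k, p k v x := by
  choose A hA hA' h using hp
  refine ⟨⋃ k, A k, Set.finite_iUnion hA, ?_, fun v x => ?_⟩
  · simp only [Set.mem_iUnion]
    rintro L ⟨k, hk⟩
    exact hA' k L hk
  · simp only [h, Set.mem_iUnion]
    exact ⟨fun H L ⟨k, hk⟩ => H k L hk, fun H k L hk => H L ⟨k, hk⟩⟩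

lemma const_imp {q : Prop} {p : (ι → ℝ) → (J → ℝ) → Prop} (hp : IsParamPolyhedron p) :
    IsParamPolyhedron fun v x => q → p v x := by
  by_cases hq : q
  · simpa [hq] using hp
  · exact ⟨∅, Set.finite_empty, by simp, by simp [hq]⟩

/-- Linear programs whose coefficients are computable can be solved by a program. -/
theorem exists_computable_maximizer {p : (ι → ℝ) → (J → ℝ) → Prop} (hp : IsParamPolyhedron p)
    {g : (ι → ℝ) → (J → ℝ) → ℝ} (hg : IsParamAffine g) :
    ∃ x : (ι → ℝ) → J → ℝ, (∀ j, IsComputable fun v => x v j) ∧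
      ∀ v y, p v y → (∀ z, p v z → g v z ≤ g v y) → p v (x v) ∧ g v y ≤ g v (x v) := by
  obtain ⟨A, hfin, hA, h⟩ := hp
  let e := Fintype.equivFin J
  have hcomp : ∀ L : (ι → ℝ) → (J → ℝ) → ℝ, IsParamAffine L →
      IsParamAffine fun v (x : Fin (Fintype.card J) → ℝ) => L v (x ∘ e) :=
    fun L hL => hL.comp fun j => isParamAffine_unknown (e j)
  obtain ⟨x, hx, hopt⟩ := exists_computable_maximizer_fin _
    ((fun L v (x : Fin (Fintype.card J) → ℝ) => L v (x ∘ e)) '' A) (hfin.image _)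
    (by rintro _ ⟨L, hL, rfl⟩; exact hcomp L (hA L hL)) _ (hcomp g hg)
  simp only [Set.forall_mem_image] at hopt
  refine ⟨fun v => x v ∘ e, fun j => hx (e j), fun v y hy hmax => ?_⟩
  have hye : (y ∘ e.symm) ∘ e = y := by ext; simp
  have := hopt v (y ∘ e.symm) (by simpa only [hye, h] using hy) (by
    intro z hz
    rw [hye]
    exact hmax _ ((h _ _).2 fun L hL => hz hL))
  rw [hye] at this
  exact ⟨(h _ _).2 fun L hL => this.1 hL, this.2⟩

end IsParamPolyhedron

end LinearProgram

/-! ### Farkas' lemma -/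

section Farkas

variable {E G : Type*} [AddCommGroup E] [Module ℝ E] [FiniteDimensional ℝ E]

/-- A finitely generated cone is polyhedral. Adding a generator amounts to a Fourier–Motzkin
elimination of its coefficient. -/
lemma exists_finite_halfspaces (g : G → E) (s : Finset G) :
    ∃ B : Set (E →ₗ[ℝ] ℝ), B.Finite ∧
      ∀ u, (∃ c : G → ℝ, (∀ i, 0 ≤ c i) ∧ u = ∑ i ∈ s, c i • g i) ↔ ∀ l ∈ B, 0 ≤ l u := by
  classical
  induction s using Finset.induction_on with
  | empty =>
    let b := Module.finBasis ℝ E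
    refine ⟨Set.range b.coord ∪ Set.range fun i => - b.coord i,
      (Set.finite_range _).union (Set.finite_range _), fun u => ⟨?_, fun h => ?_⟩⟩
    · rintro ⟨-, -, rfl⟩
      simp
    · refine ⟨fun _ => 0, fun _ => le_rfl, ?_⟩
      rw [Finset.sum_empty]
      refine b.ext_elem fun i => ?_
      have h1 := h (b.coord i) (Or.inl ⟨i, rfl⟩)
      have h2 := h (- b.coord i) (Or.inr ⟨i, rfl⟩)
      simp only [LinearMap.neg_apply, Module.Basis.coord_apply] at h1 h2
      simp only [map_zero, Finsupp.coe_zero, Pi.zero_apply]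
      linarith
  | insert a s ha ih =>
    obtain ⟨B, hB, h⟩ := ih
    have hstep : ∀ u, (∃ c : G → ℝ, (∀ i, 0 ≤ c i) ∧ u = ∑ i ∈ insert a s, c i • g i) ↔
        ∃ t : ℝ, 0 ≤ t ∧ ∀ l ∈ B, t * l (g a) ≤ l u := by
      intro u
      constructor
      · rintro ⟨c, hc, rfl⟩
        refine ⟨c a, hc a, fun l hl => ?_⟩
        have := (h (∑ i ∈ s, c i • g i)).1 ⟨c, hc, rfl⟩ l hl
        rw [Finset.sum_insert ha, map_add, map_smul, smul_eq_mul]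
        linarith
      · rintro ⟨t, ht, hl⟩
        obtain ⟨c, hc, hu⟩ := (h (u - t • g a)).2 fun l hlB => by
          simpa using hl l hlB
        refine ⟨Function.update c a t, fun i => ?_, ?_⟩
        · by_cases hi : i = a
          · subst hi; simpa using ht
          · simpa [hi] using hc i
        · have hs : ∑ i ∈ s, Function.update c a t i • g i = ∑ i ∈ s, c i • g i :=
            Finset.sum_congr rfl fun i hi => by
              rw [Function.update_of_ne (ne_of_mem_of_not_mem hi ha)]
          rw [Finset.sum_insert ha, hs, ← hu]
          simp
    refine ⟨{l ∈ B | 0 ≤ l (g a)} ∪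
      Set.image2 (fun l l' => l (g a) • l' - l' (g a) • l) {l ∈ B | 0 < l (g a)}
        {l ∈ B | l (g a) < 0},
      (hB.sep _).union ((hB.sep _).image2 _ (hB.sep _)), fun u => ?_⟩
    rw [hstep]
    constructor
    · rintro ⟨t, ht, hl⟩ _ (⟨hlB, hl0⟩ | ⟨l, ⟨hlB, hl0⟩, l', ⟨hlB', hl0'⟩, rfl⟩)
      · exact (mul_nonneg ht hl0).trans (hl _ hlB)
      · have h1 := mul_le_mul_of_nonneg_left (hl l' hlB') hl0.le
        have h2 := mul_le_mul_of_nonneg_left (hl l hlB) (neg_pos.2 hl0').le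
        simp only [LinearMap.sub_apply, LinearMap.smul_apply, smul_eq_mul]
        linarith
    · intro hu
      rcases Set.eq_empty_or_nonempty {l ∈ B | l (g a) < 0} with hN | hN
      · refine ⟨0, le_rfl, fun l hl => ?_⟩
        have : ¬ l (g a) < 0 := fun hlt => by
          have : l ∈ {l ∈ B | l (g a) < 0} := ⟨hl, hlt⟩
          simp [hN] at this
        simpa using hu l (Or.inl ⟨hl, not_lt.1 this⟩)
      · obtain ⟨m, ⟨hmB, hm⟩, hmax⟩ :=
          (hB.sep fun l => l (g a) < 0).exists_maximalFor (fun l => l u / l (g a)) _ hN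
        refine ⟨max 0 (m u / m (g a)), le_max_left _ _, fun l hl => ?_⟩
        rcases lt_trichotomy (l (g a)) 0 with hlt | heq | hgt
        · have h1 : l u / l (g a) ≤ max 0 (m u / m (g a)) := by
            refine le_max_of_le_right ?_
            rcases le_total (l u / l (g a)) (m u / m (g a)) with h' | h'
            · exact h'
            · exact hmax (show l ∈ {l ∈ B | l (g a) < 0} from ⟨hl, hlt⟩) h'
          rwa [div_le_iff_of_neg hlt] at h1
        · rw [heq, mul_zero]
          exact hu l (Or.inl ⟨hl, heq.ge⟩)
        · have h0 := hu l (Or.inl ⟨hl, hgt.le⟩)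
          have h1 := hu _ (Or.inr ⟨l, ⟨hl, hgt⟩, m, ⟨hmB, hm⟩, rfl⟩)
          simp only [LinearMap.sub_apply, LinearMap.smul_apply, smul_eq_mul] at h1
          rw [← le_div_iff₀ hgt, max_le_iff]
          refine ⟨div_nonneg h0 hgt.le, ?_⟩
          rw [div_le_iff_of_neg hm, div_mul_eq_mul_div, div_le_iff₀ hgt]
          linarith

/-- Farkas' lemma. -/
theorem mem_cone_of_forall_nonneg [Fintype G] (g : G → E) (u : E)
    (h : ∀ l : E →ₗ[ℝ] ℝ, (∀ i, 0 ≤ l (g i)) → 0 ≤ l u) :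
    ∃ c : G → ℝ, (∀ i, 0 ≤ c i) ∧ u = ∑ i, c i • g i := by
  classical
  obtain ⟨B, -, hB⟩ := exists_finite_halfspaces g Finset.univ
  refine (hB u).2 fun l hl => h l fun i => (hB (g i)).1 ⟨Pi.single i 1, fun k => ?_, ?_⟩ l hl
  · by_cases hk : k = i
    · subst hk; simp
    · simp [hk]
  · simp [Pi.single_apply, ite_smul]

end Farkas

/-! ### Sums over the nodes of a finite filtration -/

section Nodes

variable {Ω : Type*} {m m' : MeasurableSpace Ω}

/-- The atom of `m` which contains `ω`, that is, the node of the corresponding date. -/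
abbrev node (m : MeasurableSpace Ω) (ω : Ω) : Set Ω := @measurableAtom Ω m ω

lemma mem_node_self (m : MeasurableSpace Ω) (ω : Ω) : ω ∈ node m ω :=
  @mem_measurableAtom_self Ω m ω

lemma node_eq_of_mem {ω ω' : Ω} (h : ω' ∈ node m ω) : node m ω' = node m ω :=
  @measurableAtom_eq_of_mem Ω m ω' ω h

lemma mem_node_comm {ω ω' : Ω} : ω' ∈ node m ω ↔ ω ∈ node m ω' :=
  ⟨fun h => node_eq_of_mem h ▸ mem_node_self m ω, fun h => node_eq_of_mem h ▸ mem_node_self m ω'⟩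

lemma node_anti (h : m ≤ m') (ω : Ω) : node m' ω ⊆ node m ω := by
  intro ω' hω'
  simp only [node, measurableAtom, Set.mem_iInter] at hω' ⊢
  exact fun s hs hms => hω' s hs (h s hms)

lemma measurableSet_node [Finite Ω] (m : MeasurableSpace Ω) (ω : Ω) :
    MeasurableSet[m] (node m ω) :=
  @MeasurableSet.measurableAtom_of_countable Ω m _ ω

/-- On a finite space the measurable functions are those which are constant on the nodes. -/
lemma measurable_iff_forall_mem_node [Finite Ω] {E : Type*} [MeasurableSpace E]
    [MeasurableSingletonClass E] {f : Ω → E} :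
    Measurable[m] f ↔ ∀ ω, ∀ ω' ∈ node m ω, f ω' = f ω := by
  constructor
  · intro hf ω ω' hω'
    exact @mem_of_mem_measurableAtom Ω m ω ω' hω' _ (hf (measurableSet_singleton (f ω))) rfl
  · intro h s _
    have : f ⁻¹' s = ⋃ ω ∈ f ⁻¹' s, node m ω := by
      ext ω
      simp only [Set.mem_iUnion, Set.mem_preimage]
      refine ⟨fun hω => ⟨ω, hω, mem_node_self m ω⟩, ?_⟩
      rintro ⟨ω', hω', hmem⟩
      rwa [h ω' ω hmem]
    rw [this]
    exact MeasurableSet.biUnion (Set.to_countable _) fun ω _ => measurableSet_node m ω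

variable [Fintype Ω]

open Classical in
/-- The sum of `a` over the node of `ω`. -/
noncomputable def nodeSum (m : MeasurableSpace Ω) (a : Ω → ℝ) (ω : Ω) : ℝ :=
  ∑ ω', if ω' ∈ node m ω then a ω' else 0

lemma nodeSum_congr_node (a : Ω → ℝ) {ω ω' : Ω} (h : ω' ∈ node m ω) :
    nodeSum m a ω' = nodeSum m a ω := by
  unfold nodeSum
  rw [node_eq_of_mem h]

lemma nodeSum_one_pos (m : MeasurableSpace Ω) (ω : Ω) : 0 < nodeSum m (fun _ => 1) ω := by
  classical
  refine Finset.sum_pos' (fun _ _ => by split_ifs <;> norm_num) ⟨ω, Finset.mem_univ _, ?_⟩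
  simp

lemma nodeSum_mul_right (a : Ω → ℝ) {f : Ω → ℝ} (hf : ∀ ω, ∀ ω' ∈ node m ω, f ω' = f ω)
    (ω : Ω) : nodeSum m (fun ω' => a ω' * f ω') ω = nodeSum m a ω * f ω := by
  classical
  simp only [nodeSum, Finset.sum_mul, ite_mul, zero_mul]
  refine Finset.sum_congr rfl fun ω' _ => ?_
  split_ifs with h
  · rw [hf ω ω' h]
  · rfl

lemma nodeSum_add (a b : Ω → ℝ) (ω : Ω) :
    nodeSum m (fun ω' => a ω' + b ω') ω = nodeSum m a ω + nodeSum m b ω := by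
  classical
  simp only [nodeSum, ← Finset.sum_add_distrib]
  exact Finset.sum_congr rfl fun ω' _ => by split_ifs <;> simp

lemma nodeSum_const_mul (c : ℝ) (a : Ω → ℝ) (ω : Ω) :
    nodeSum m (fun ω' => c * a ω') ω = c * nodeSum m a ω := by
  classical
  simp only [nodeSum, Finset.mul_sum, mul_ite, mul_zero]

/-- Integrating against a measurable function only depends on the averages over the nodes. -/
lemma sum_mul_eq_sum_average_mul (a : Ω → ℝ) {f : Ω → ℝ}
    (hf : ∀ ω, ∀ ω' ∈ node m ω, f ω' = f ω) :
    ∑ ω, a ω * f ω = ∑ ω, nodeSum m a ω / nodeSum m (fun _ => 1) ω * f ω := by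
  classical
  have h1 : ∀ ω, nodeSum m a ω / nodeSum m (fun _ => 1) ω * f ω =
      ∑ ω', if ω' ∈ node m ω then a ω' * (f ω' / nodeSum m (fun _ => 1) ω') else 0 := by
    intro ω
    rw [nodeSum, div_mul_eq_mul_div, mul_div_assoc, Finset.sum_mul]
    refine Finset.sum_congr rfl fun ω' _ => ?_
    split_ifs with h
    · rw [hf ω ω' h, nodeSum_congr_node _ h]
    · simp
  simp only [h1]
  rw [Finset.sum_comm]
  refine Finset.sum_congr rfl fun ω' _ => ?_
  have h2 : (∑ ω, if ω' ∈ node m ω then a ω' * (f ω' / nodeSum m (fun _ => 1) ω') else 0) =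
      a ω' * (f ω' / nodeSum m (fun _ => 1) ω') * nodeSum m (fun _ => 1) ω' := by
    rw [nodeSum, Finset.mul_sum]
    refine Finset.sum_congr rfl fun ω _ => ?_
    rw [mul_ite, mul_one, mul_zero]
    exact if_congr mem_node_comm rfl rfl
  rw [h2, mul_assoc, div_mul_cancel₀ _ (nodeSum_one_pos m ω').ne']

lemma sum_mul_congr_of_nodeSum_eq {a b : Ω → ℝ} (h : ∀ ω, nodeSum m a ω = nodeSum m b ω)
    {f : Ω → ℝ} (hf : ∀ ω, ∀ ω' ∈ node m ω, f ω' = f ω) :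
    ∑ ω, a ω * f ω = ∑ ω, b ω * f ω := by
  rw [sum_mul_eq_sum_average_mul a hf, sum_mul_eq_sum_average_mul b hf]
  simp only [h]

end Nodes

/-! ### Solvency cones and their duals -/

section Cones

variable {Ω : Type*} {T d : ℕ} {rate : Fin (T + 1) → Fin d → Fin d → Ω → ℝ}

/-- An explicit form of the dual of the solvency cone at the node of `ω`: prices are non-negative,
and no exchange between two assets is profitable. -/
def priceCone (rate : Fin (T + 1) → Fin d → Fin d → Ω → ℝ) (t : Fin (T + 1)) (ω : Ω) :
    Set (Fin d → ℝ) :=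
  {y | (∀ k, 0 ≤ y k) ∧ ∀ i k, y k ≤ rate t i k ω * y i}

lemma eq_zero_of_mem_priceCone {t : Fin (T + 1)} {ω : Ω} {y : Fin d → ℝ}
    (hy : y ∈ priceCone rate t ω) {j : Fin d} (hj : y j = 0) : y = 0 := by
  funext k
  have := hy.2 j k
  rw [hj, mul_zero] at this
  exact le_antisymm this (hy.1 k)

lemma smul_mem_priceCone {t : Fin (T + 1)} {ω : Ω} {y : Fin d → ℝ}
    (hy : y ∈ priceCone rate t ω) {c : ℝ} (hc : 0 ≤ c) : c • y ∈ priceCone rate t ω :=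
  ⟨fun k => mul_nonneg hc (hy.1 k), fun i k => by
    have := mul_le_mul_of_nonneg_left (hy.2 i k) hc
    simp only [Pi.smul_apply, smul_eq_mul]
    linarith⟩

lemma add_mem_priceCone {t : Fin (T + 1)} {ω : Ω} {y z : Fin d → ℝ}
    (hy : y ∈ priceCone rate t ω) (hz : z ∈ priceCone rate t ω) :
    y + z ∈ priceCone rate t ω :=
  ⟨fun k => add_nonneg (hy.1 k) (hz.1 k), fun i k => by
    have := add_le_add (hy.2 i k) (hz.2 i k)
    simp only [Pi.add_apply]
    linarith⟩

variable [mΩ : MeasurableSpace Ω] [Finite Ω] {ℱ : Filtration (Fin (T + 1)) mΩ}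

/-- A portfolio is solvent if it is the sum of non-negative holdings `p` and of what the exchanges
`β`, when reversed, return. -/
lemma mem_solvencyCone_iff (hr : IsExchangeRates ℱ rate) {t : Fin (T + 1)}
    {x : Ω → Fin d → ℝ} :
    x ∈ solvencyCone ℱ rate t ↔ ∃ (p : Ω → Fin d → ℝ) (β : Fin d → Fin d → Ω → ℝ),
      Measurable[ℱ t] p ∧ (∀ ω k, 0 ≤ p ω k) ∧ (∀ j k, Measurable[ℱ t] (β j k)) ∧
      (∀ j k ω, 0 ≤ β j k ω) ∧
      ∀ ω k, x ω k = p ω k - ∑ j, β j k ω + ∑ j, β k j ω * rate t k j ω := by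
  constructor
  · rintro ⟨-, p, hp, hp0, β, hβ, hβ0, h⟩
    exact ⟨p, β, hp, hp0, hβ, hβ0, fun ω k => by rw [h]; ring⟩
  · rintro ⟨p, β, hp, hp0, hβ, hβ0, h⟩
    refine ⟨?_, p, hp, hp0, β, hβ, hβ0, fun ω k => by rw [h]; ring⟩
    rw [measurable_iff_forall_mem_node] at hp ⊢
    intro ω ω' hω
    funext k
    rw [h, h, hp ω ω' hω]
    simp only [measurable_iff_forall_mem_node.1 (hβ _ _) ω ω' hω,
      measurable_iff_forall_mem_node.1 (hr.measurable _ _ _) ω ω' hω]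

lemma zero_mem_solvencyCone (hr : IsExchangeRates ℱ rate) (t : Fin (T + 1)) :
    0 ∈ solvencyCone ℱ rate t :=
  (mem_solvencyCone_iff hr).2 ⟨0, 0, measurable_iff_forall_mem_node.2 (by simp), by simp,
    fun _ _ => measurable_iff_forall_mem_node.2 (by simp), by simp, by simp⟩

lemma add_mem_solvencyCone (hr : IsExchangeRates ℱ rate) {t : Fin (T + 1)}
    {x x' : Ω → Fin d → ℝ} (hx : x ∈ solvencyCone ℱ rate t) (hx' : x' ∈ solvencyCone ℱ rate t) :
    x + x' ∈ solvencyCone ℱ rate t := by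
  rw [mem_solvencyCone_iff hr] at *
  obtain ⟨p, β, hp, hp0, hβ, hβ0, h⟩ := hx
  obtain ⟨p', β', hp', hp0', hβ', hβ0', h'⟩ := hx'
  simp only [measurable_iff_forall_mem_node] at *
  refine ⟨p + p', β + β', ?_, fun ω k => add_nonneg (hp0 ω k) (hp0' ω k), ?_,
    fun j k ω => add_nonneg (hβ0 j k ω) (hβ0' j k ω), fun ω k => ?_⟩
  · intro ω ω' hω
    simp [hp ω ω' hω, hp' ω ω' hω]
  · intro j k ω ω' hω
    simp [hβ j k ω ω' hω, hβ' j k ω ω' hω]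
  · simp only [Pi.add_apply, h, h', Finset.sum_add_distrib, add_mul]
    ring

lemma smul_mem_solvencyCone (hr : IsExchangeRates ℱ rate) {t : Fin (T + 1)} {c : ℝ} (hc : 0 ≤ c)
    {x : Ω → Fin d → ℝ} (hx : x ∈ solvencyCone ℱ rate t) : c • x ∈ solvencyCone ℱ rate t := by
  rw [mem_solvencyCone_iff hr] at *
  obtain ⟨p, β, hp, hp0, hβ, hβ0, h⟩ := hx
  simp only [measurable_iff_forall_mem_node] at *
  refine ⟨c • p, c • β, ?_, fun ω k => mul_nonneg hc (hp0 ω k), ?_,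
    fun j k ω => mul_nonneg hc (hβ0 j k ω), fun ω k => ?_⟩
  · intro ω ω' hω
    simp [hp ω ω' hω]
  · intro j k ω ω' hω
    simp [hβ j k ω ω' hω]
  · simp only [Pi.smul_apply, smul_eq_mul, h, mul_assoc, ← Finset.mul_sum]
    ring

lemma sum_mem_solvencyCone (hr : IsExchangeRates ℱ rate) {t : Fin (T + 1)} {κ : Type*}
    (s : Finset κ) {x : κ → Ω → Fin d → ℝ} (hx : ∀ k, x k ∈ solvencyCone ℱ rate t) :
    ∑ k ∈ s, x k ∈ solvencyCone ℱ rate t :=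
  Finset.sum_induction _ (· ∈ solvencyCone ℱ rate t) (fun _ _ => add_mem_solvencyCone hr)
    (zero_mem_solvencyCone hr t) fun k _ => hx k

/-- Indices of the generators of the solvency cones: a date, a node (through one of its points),
and an asset or a pair of assets. -/
abbrev GeneratorIndex (Ω : Type*) (T d : ℕ) :=
  Fin (T + 1) × Ω × (Fin d ⊕ Fin d × Fin d)

open Classical in
/-- The generators of the solvency cones: at each node the unit vectors, and the vectors
`π^{ik} e^i - e^k`. -/
noncomputable def generator (ℱ : Filtration (Fin (T + 1)) mΩ)
    (rate : Fin (T + 1) → Fin d → Fin d → Ω → ℝ) :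
    GeneratorIndex Ω T d → Ω → Fin d → ℝ
  | (t, ω₀, .inl k), ω, l => if ω ∈ node (ℱ t) ω₀ then (if l = k then 1 else 0) else 0
  | (t, ω₀, .inr (i, k)), ω, l =>
      if ω ∈ node (ℱ t) ω₀ then (if l = i then rate t i k ω₀ else 0) - (if l = k then 1 else 0)
      else 0

lemma generator_mem_solvencyCone (hr : IsExchangeRates ℱ rate) (t : Fin (T + 1))
    (a : Ω × (Fin d ⊕ Fin d × Fin d)) : generator ℱ rate (t, a) ∈ solvencyCone ℱ rate t := by
  classical
  rw [mem_solvencyCone_iff hr]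
  simp only [measurable_iff_forall_mem_node]
  obtain ⟨ω₀, k | ⟨i, k⟩⟩ := a
  · refine ⟨generator ℱ rate (t, ω₀, .inl k), 0, fun ω ω' hω => ?_, fun ω l => ?_, by simp,
      by simp, by simp⟩
    · funext l
      simp only [generator, mem_node_comm (ω := ω₀), node_eq_of_mem hω]
    · simp only [generator]
      split_ifs <;> norm_num
  · refine ⟨0, fun i' k' ω => if ω ∈ node (ℱ t) ω₀ then (if i' = i ∧ k' = k then 1 else 0) else 0,
      by simp, by simp, fun i' k' ω ω' hω => ?_, fun i' k' ω => ?_, fun ω l => ?_⟩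
    · simp only [mem_node_comm (ω := ω₀), node_eq_of_mem hω]
    · dsimp only
      split_ifs <;> norm_num
    · by_cases hω : ω ∈ node (ℱ t) ω₀
      · have h1 := measurable_iff_forall_mem_node.1 (hr.measurable t i k) ω₀ ω hω
        simp only [generator, hω, if_true, ← h1]
        by_cases h2 : l = k <;> by_cases h3 : l = i <;> simp [h2, h3, ite_and] <;> grind
      · simp [generator, hω]

/-- The explicit form of the dual cone of the solvency cone at a node. -/
lemma dualCone_nodeSet_solvencyCone (hr : IsExchangeRates ℱ rate) (t : Fin (T + 1)) (ω : Ω) :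
    dualCone (nodeSet (solvencyCone ℱ rate t) ω) = priceCone rate t ω := by
  classical
  ext y
  constructor
  · intro h
    have key := fun a => h _ (Set.mem_image_of_mem _ (generator_mem_solvencyCone hr t (ω, a)))
    refine ⟨fun k => ?_, fun i k => ?_⟩
    · simpa [generator, dotProduct] using key (.inl k)
    · have := key (.inr (i, k))
      simp [generator, dotProduct, mul_sub, Finset.sum_sub_distrib] at this
      linarith
  · rintro ⟨h0, h⟩ _ ⟨x, hx, rfl⟩
    obtain ⟨p, β, -, hp0, -, hβ0, hxe⟩ := (mem_solvencyCone_iff hr).1 hx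
    have : y ⬝ᵥ x ω = ∑ k, y k * p ω k +
        ∑ i, ∑ k, β i k ω * (rate t i k ω * y i - y k) := by
      simp only [dotProduct, hxe, mul_sub, mul_add, Finset.sum_sub_distrib,
        Finset.sum_add_distrib, Finset.mul_sum]
      rw [Finset.sum_comm (f := fun k j => y k * β j k ω)]
      have e1 : ∑ i, ∑ k, y k * β i k ω = ∑ i, ∑ k, β i k ω * y k := by
        simp only [mul_comm]
      have e2 : ∑ i, ∑ k, y i * (β i k ω * rate t i k ω) =
          ∑ i, ∑ k, β i k ω * (rate t i k ω * y i) :=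
        Finset.sum_congr rfl fun i _ => Finset.sum_congr rfl fun k _ => by ring
      rw [e1, e2]
      ring
    change 0 ≤ y ⬝ᵥ x ω
    rw [this]
    exact add_nonneg (Finset.sum_nonneg fun k _ => mul_nonneg (h0 k) (hp0 ω k))
      (Finset.sum_nonneg fun i _ => Finset.sum_nonneg fun k _ =>
        mul_nonneg (hβ0 i k ω) (sub_nonneg.2 (h i k)))

end Cones

section Duality

variable {Ω : Type*} [Fintype Ω] {T d : ℕ}

/-- The value of the random portfolio `u` under the weighted prices `Z`. -/
def pairing (Z u : Ω → Fin d → ℝ) : ℝ := ∑ ω, Z ω ⬝ᵥ u ω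

lemma pairing_add_right (Z u u' : Ω → Fin d → ℝ) :
    pairing Z (u + u') = pairing Z u + pairing Z u' := by
  simp [pairing, dotProduct_add, Finset.sum_add_distrib]

lemma pairing_smul_left (c : ℝ) (Z u : Ω → Fin d → ℝ) :
    pairing (c • Z) u = c * pairing Z u := by
  simp [pairing, smul_dotProduct, Finset.mul_sum]

lemma pairing_neg_right (Z u : Ω → Fin d → ℝ) : pairing Z (-u) = - pairing Z u := by
  simp [pairing]

lemma pairing_sum_right {κ : Type*} (s : Finset κ) (Z : Ω → Fin d → ℝ)
    (u : κ → Ω → Fin d → ℝ) : pairing Z (∑ i ∈ s, u i) = ∑ i ∈ s, pairing Z (u i) := by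
  simp only [pairing, Finset.sum_apply, dotProduct_sum]
  rw [Finset.sum_comm]

lemma pairing_eq_sum_coord (Z u : Ω → Fin d → ℝ) :
    pairing Z u = ∑ k, ∑ ω, Z ω k * u ω k := by
  rw [Finset.sum_comm]
  rfl

variable [mΩ : MeasurableSpace Ω] {ℱ : Filtration (Fin (T + 1)) mΩ}
  {rate : Fin (T + 1) → Fin d → Fin d → Ω → ℝ}

/-- The sums of `Z` over the node of `ω` at date `t`. -/
noncomputable def nodePrice (ℱ : Filtration (Fin (T + 1)) mΩ) (Z : Ω → Fin d → ℝ)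
    (t : Fin (T + 1)) (ω : Ω) : Fin d → ℝ :=
  fun k => nodeSum (ℱ t) (fun ω' => Z ω' k) ω

/-- The terminal values `Z` of weighted price processes: the sums of `Z` over the nodes of each
date `t` lie in the dual of the solvency cone at date `t`. For a pricing pair `(Q, S)` the product
of the weights of `Q` with `S_T` is of this form. -/
def weightedPrices (ℱ : Filtration (Fin (T + 1)) mΩ)
    (rate : Fin (T + 1) → Fin d → Fin d → Ω → ℝ) : Set (Ω → Fin d → ℝ) :=
  {Z | ∀ t ω, nodePrice ℱ Z t ω ∈ priceCone rate t ω}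

lemma zero_mem_weightedPrices : 0 ∈ weightedPrices ℱ rate := by
  intro t ω
  simp [nodePrice, nodeSum, priceCone]

lemma add_mem_weightedPrices {Z Z' : Ω → Fin d → ℝ} (hZ : Z ∈ weightedPrices ℱ rate)
    (hZ' : Z' ∈ weightedPrices ℱ rate) : Z + Z' ∈ weightedPrices ℱ rate := by
  intro t ω
  convert add_mem_priceCone (hZ t ω) (hZ' t ω) using 1
  funext k
  exact nodeSum_add _ _ _

lemma smul_mem_weightedPrices {Z : Ω → Fin d → ℝ} (hZ : Z ∈ weightedPrices ℱ rate) {c : ℝ}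
    (hc : 0 ≤ c) : c • Z ∈ weightedPrices ℱ rate := by
  intro t ω
  convert smul_mem_priceCone (hZ t ω) hc using 1
  funext k
  exact nodeSum_const_mul _ _ _

lemma pairing_nonneg_of_mem_solvencyCone (hr : IsExchangeRates ℱ rate) {Z : Ω → Fin d → ℝ}
    (hZ : Z ∈ weightedPrices ℱ rate) {t : Fin (T + 1)} {x : Ω → Fin d → ℝ}
    (hx : x ∈ solvencyCone ℱ rate t) : 0 ≤ pairing Z x := by
  have hm := measurable_iff_forall_mem_node.1 hx.1
  have : pairing Z x = ∑ ω, (nodeSum (ℱ t) (fun _ => 1) ω)⁻¹ *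
      (nodePrice ℱ Z t ω ⬝ᵥ x ω) := by
    rw [pairing_eq_sum_coord]
    have h1 := fun k => sum_mul_eq_sum_average_mul (m := ℱ t) (fun ω => Z ω k)
      (f := fun ω => x ω k) fun ω ω' hω => by simp only [hm ω ω' hω]
    simp only [h1]
    rw [Finset.sum_comm]
    refine Finset.sum_congr rfl fun ω _ => ?_
    rw [dotProduct, Finset.mul_sum]
    exact Finset.sum_congr rfl fun k _ => by rw [nodePrice]; ring
  rw [this]
  refine Finset.sum_nonneg fun ω _ => mul_nonneg (inv_nonneg.2 (nodeSum_one_pos _ ω).le) ?_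
  have hmem := hZ t ω
  rw [← dualCone_nodeSet_solvencyCone hr] at hmem
  exact hmem _ (Set.mem_image_of_mem _ hx)

/-- By Farkas' lemma, a random portfolio is a combination of the generators as soon as its value is
non-negative under all weighted prices. -/
lemma exists_generator_combination (u : Ω → Fin d → ℝ)
    (h : ∀ Z ∈ weightedPrices ℱ rate, 0 ≤ pairing Z u) :
    ∃ c : GeneratorIndex Ω T d → ℝ, (∀ a, 0 ≤ c a) ∧ u = ∑ a, c a • generator ℱ rate a := by
  classical
  refine mem_cone_of_forall_nonneg _ _ fun l hl => ?_
  -- the weighted prices which represent the functional `l`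
  let Z : Ω → Fin d → ℝ := fun ω k => l (Pi.single ω (Pi.single k 1))
  have hlZ : ∀ x, l x = pairing Z x := by
    intro x
    have hx : x = ∑ ω, ∑ k, x ω k • (Pi.single ω (Pi.single k 1) : Ω → Fin d → ℝ) := by
      funext ω k
      simp only [Finset.sum_apply, Pi.smul_apply, smul_eq_mul, Pi.single_apply]
      rw [Finset.sum_eq_single ω, Finset.sum_eq_single k]
      · simp
      · intro b _ hb
        simp [hb.symm]
      · simp
      · intro b _ hb
        simp [hb.symm]
      · simp
    conv_lhs => rw [hx]
    simp only [map_sum, map_smul, smul_eq_mul, pairing, dotProduct, Z]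
    exact Finset.sum_congr rfl fun ω _ => Finset.sum_congr rfl fun k _ => mul_comm _ _
  rw [hlZ]
  refine h Z fun t ω => ⟨fun k => ?_, fun i k => ?_⟩
  · have h1 := hl (t, ω, .inl k)
    rw [hlZ] at h1
    have h2 : pairing Z (generator ℱ rate (t, ω, .inl k)) =
        nodeSum (ℱ t) (fun ω' => Z ω' k) ω := by
      refine Finset.sum_congr rfl fun ω' _ => ?_
      by_cases hω : ω' ∈ node (ℱ t) ω <;> simp [generator, dotProduct, hω]
    rw [h2] at h1
    exact h1
  · have h1 := hl (t, ω, .inr (i, k))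
    rw [hlZ] at h1
    have h2 : pairing Z (generator ℱ rate (t, ω, .inr (i, k))) =
        rate t i k ω * nodeSum (ℱ t) (fun ω' => Z ω' i) ω -
          nodeSum (ℱ t) (fun ω' => Z ω' k) ω := by
      rw [nodeSum, nodeSum, Finset.mul_sum, ← Finset.sum_sub_distrib]
      refine Finset.sum_congr rfl fun ω' _ => ?_
      by_cases hω : ω' ∈ node (ℱ t) ω
      · simp [generator, dotProduct, hω, mul_sub, Finset.sum_sub_distrib]
        ring
      · simp [generator, dotProduct, hω]
    rw [h2] at h1
    simp only [nodePrice]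
    linarith

lemma exists_solvent_sum_of_generator_combination (hr : IsExchangeRates ℱ rate)
    {c : GeneratorIndex Ω T d → ℝ} (hc : ∀ a, 0 ≤ c a) :
    ∃ k : Fin (T + 1) → Ω → Fin d → ℝ, (∀ t, k t ∈ solvencyCone ℱ rate t) ∧
      ∑ a, c a • generator ℱ rate a = ∑ t, k t := by
  refine ⟨fun t => ∑ a, c (t, a) • generator ℱ rate (t, a), fun t => ?_, ?_⟩
  · exact sum_mem_solvencyCone hr _ fun a =>
      smul_mem_solvencyCone hr (hc _) (generator_mem_solvencyCone hr t a)
  · rw [Fintype.sum_prod_type]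

lemma pairing_nonneg_of_eq_sum (hr : IsExchangeRates ℱ rate)
    {k : Fin (T + 1) → Ω → Fin d → ℝ} (hk : ∀ t, k t ∈ solvencyCone ℱ rate t)
    {Z : Ω → Fin d → ℝ} (hZ : Z ∈ weightedPrices ℱ rate) : 0 ≤ pairing Z (∑ t, k t) := by
  rw [pairing_sum_right]
  exact Finset.sum_nonneg fun t _ => pairing_nonneg_of_mem_solvencyCone hr hZ (hk t)

end Duality

/-! ### Strategies as sums of solvent portfolios -/

section Strategies

variable {Ω : Type*} [mΩ : MeasurableSpace Ω] [Finite Ω] {T d : ℕ}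
  {ℱ : Filtration (Fin (T + 1)) mΩ} {rate : Fin (T + 1) → Fin d → Fin d → Ω → ℝ}

/-- The strategy which starts from `x₀`, receives `w t` at date `t` and disposes of `k t` at date
`t`. Since a strategy ends with the value zero, at the last date everything is disposed of; this is
`k (Fin.last T)` precisely if the total of `k` is `x₀` plus the total of `w`. -/
lemma exists_tradingStrategy (x₀ : Fin d → ℝ) {w k : Fin (T + 1) → Ω → Fin d → ℝ}
    (hw : ∀ t, Measurable[ℱ t] (w t)) (hk : ∀ t, Measurable[ℱ t] (k t)) :
    ∃ y ∈ tradingStrategies ℱ d, (∀ ω, y 0 ω = x₀) ∧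
      (∀ t ≠ Fin.last T, ∀ ω, y t.castSucc ω + w t ω - y t.succ ω = k t ω) ∧
      (∀ ω, y (Fin.last T).castSucc ω + w (Fin.last T) ω =
        x₀ + ∑ t, (w t ω - k t ω) + k (Fin.last T) ω) := by
  classical
  simp only [measurable_iff_forall_mem_node] at hw hk
  refine ⟨fun t ω => if t = Fin.last (T + 1) then 0 else
    x₀ + ∑ s with Fin.castSucc s < t, (w s ω - k s ω),
    ⟨⟨x₀, fun ω => ?_⟩, fun t => ?_, fun ω => ?_⟩,
    fun ω => ?_, fun t ht ω => ?_, fun ω => ?_⟩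
  · dsimp only
    rw [if_neg (Fin.last_pos.ne)]
    simp
  · rw [measurable_iff_forall_mem_node]
    intro ω ω' hω
    dsimp only
    split_ifs
    · rfl
    · congr 1
      refine Finset.sum_congr rfl fun s hs => ?_
      have hs : s ≤ t := by simpa [Fin.castSucc_lt_succ_iff] using hs
      have hω' := node_anti (ℱ.mono hs) ω hω
      rw [hw s ω ω' hω', hk s ω ω' hω']
  · simp
  · dsimp only
    rw [if_neg (Fin.last_pos.ne)]
    simp
  · have h1 : t.succ ≠ Fin.last (T + 1) := by
      rwa [← Fin.succ_last, Ne, Fin.succ_inj]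
    have h2 : (Finset.univ.filter fun s : Fin (T + 1) => s.castSucc < t.succ) =
        insert t (Finset.univ.filter fun s : Fin (T + 1) => s.castSucc < t.castSucc) := by
      ext s
      simp [Fin.castSucc_lt_succ_iff, le_iff_eq_or_lt]
    dsimp only
    rw [if_neg h1, if_neg (Fin.castSucc_lt_last t).ne, h2, Finset.sum_insert (by simp)]
    abel
  · have h2 : (Finset.univ : Finset (Fin (T + 1))) = insert (Fin.last T)
        (Finset.univ.filter fun s : Fin (T + 1) => s.castSucc < (Fin.last T).castSucc) := by
      ext s
      simp [(Fin.le_last s).eq_or_lt]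
    dsimp only
    rw [if_neg (Fin.castSucc_lt_last _).ne]
    conv_rhs => rw [h2, Finset.sum_insert (by simp)]
    abel

/-- Without arbitrage, the negative of a non-zero portfolio with non-negative holdings is not a sum
of solvent portfolios, one for each date. -/
lemma NoArbitrage.neg_ne_sum (hna : NoArbitrage ℱ rate)
    (h_last : ℱ (Fin.last T) = ⊤) {x : Ω → Fin d → ℝ} (hx : x ≠ 0) (hx0 : ∀ ω k, 0 ≤ x ω k)
    {k : Fin (T + 1) → Ω → Fin d → ℝ} (hk : ∀ t, k t ∈ solvencyCone ℱ rate t) :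
    -x ≠ ∑ t, k t := by
  intro hsum
  obtain ⟨y, hy, hy0, hyt, hyT⟩ := exists_tradingStrategy (ℱ := ℱ) 0 (w := fun _ _ => 0)
    (fun t => measurable_iff_forall_mem_node.2 fun _ _ _ => rfl) (fun t => (hk t).1)
  refine hna ⟨y, hy, fun t ht => ?_, hy0, x, ?_, hx, hx0, ?_⟩
  · convert hk t using 1
    funext ω
    simpa using hyt t ht ω
  · rw [h_last]
    exact fun _ _ => trivial
  · convert hk (Fin.last T) using 1
    funext ω
    have h1 := hyT ω
    have h2 : ∑ t, k t ω = - x ω := by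
      have := congrFun hsum ω
      simpa using this.symm
    simp only [zero_sub, Finset.sum_neg_distrib, h2] at h1
    simpa using congrArg (· - x ω) h1

/-- The value at `ω` of the payoff process `ξ` exercised at the mixed stopping time `χ`. -/
def mixedPayoff (ξ : Fin (T + 1) → Ω → Fin d → ℝ) (χ : Fin (T + 1) → Ω → ℝ) :
    Ω → Fin d → ℝ :=
  fun ω => ∑ t, χ t ω • ξ t ω

/-- The buyer can hedge with initial endowment `x₀` if and only if the endowment together with the
mixed payoff is a sum of solvent portfolios, one for each date. -/
lemma exists_buyerStrategy_iff {ξ : Fin (T + 1) → Ω → Fin d → ℝ}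
    (hξ : ∀ t, Measurable[ℱ t] (ξ t)) {χ : Fin (T + 1) → Ω → ℝ}
    (hχ : χ ∈ mixedStoppingTimes ℱ) (x₀ : Fin d → ℝ) :
    (∃ y, (y, χ) ∈ buyerStrategies ℱ rate ξ ∧ ∀ ω, y 0 ω = x₀) ↔
      ∃ k : Fin (T + 1) → Ω → Fin d → ℝ, (∀ t, k t ∈ solvencyCone ℱ rate t) ∧
        (fun _ => x₀) + mixedPayoff ξ χ = ∑ t, k t := by
  constructor
  · rintro ⟨y, ⟨⟨-, -, hyT⟩, -, hy⟩, hy0⟩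
    refine ⟨_, hy, ?_⟩
    funext ω
    have h1 : y 0 ω + ∑ t : Fin (T + 1), y t.succ ω =
        ∑ t : Fin (T + 1), y t.castSucc ω + y (Fin.last _) ω := by
      rw [← Fin.sum_univ_succ (fun t => y t ω), ← Fin.sum_univ_castSucc (fun t => y t ω)]
    simp only [Pi.add_apply, mixedPayoff, Finset.sum_apply, Finset.sum_sub_distrib,
      Finset.sum_add_distrib]
    rw [show y (Fin.last (T + 1)) ω = 0 from hyT ω, add_zero, hy0] at h1
    rw [← h1]
    abel
  · rintro ⟨k, hk, hsum⟩
    obtain ⟨y, hy, hy0, hyt, hyT⟩ := exists_tradingStrategy (ℱ := ℱ) x₀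
      (w := fun t ω => χ t ω • ξ t ω) (fun t => measurable_iff_forall_mem_node.2 fun ω ω' hω => by
        rw [measurable_iff_forall_mem_node.1 (hξ t) ω ω' hω,
          measurable_iff_forall_mem_node.1 (hχ.1 t) ω ω' hω]) (fun t => (hk t).1)
    refine ⟨y, ⟨hy, hχ, fun t => ?_⟩, hy0⟩
    convert hk t using 1
    funext ω
    by_cases ht : t = Fin.last T
    · subst ht
      have h0 : y (Fin.last T).succ ω = 0 := by simpa using hy.2.2 ω
      have h2 := congrFun hsum ω
      simp only [Pi.add_apply, mixedPayoff, Finset.sum_apply] at h2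
      simp only [h0, hyT, sub_zero, Finset.sum_sub_distrib, ← h2]
      abel
    · exact hyt t ht ω

end Strategies

/-! ### Pricing pairs and weighted prices -/

section PricingPairs

variable {Ω : Type*} [Fintype Ω] {T d : ℕ}

lemma nodeSum_top (a : Ω → ℝ) : nodeSum ⊤ a = a := by
  classical
  funext ω
  simp [nodeSum]

variable [mΩ : MeasurableSpace Ω] {ℱ : Filtration (Fin (T + 1)) mΩ}
  {rate : Fin (T + 1) → Fin d → Fin d → Ω → ℝ} {P : Measure Ω} {j : Fin d}

/-- The products of the weights of a measure with the terminal values of a price process. -/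
def pairWeights (q : Measure Ω × (Fin (T + 1) → Ω → Fin d → ℝ)) : Ω → Fin d → ℝ :=
  fun ω k => q.1.real {ω} * q.2 (Fin.last T) ω k

lemma _root_.MeasureTheory.Martingale.apply_congr_node {S : Fin (T + 1) → Ω → Fin d → ℝ}
    {Q : Measure Ω} (hS : Martingale S ℱ Q) (t : Fin (T + 1)) (ω ω' : Ω) (h : ω' ∈ node (ℱ t) ω) :
    S t ω' = S t ω :=
  measurable_iff_forall_mem_node.1 (hS.1 t).measurable ω ω' h

open Classical in
/-- The price process which belongs to the weighted prices `Z`, in units of asset `j`. At nodes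
where `Z` vanishes it is defined by the weighted prices `R`. -/
noncomputable def normalizedPrice (ℱ : Filtration (Fin (T + 1)) mΩ) (j : Fin d)
    (Z R : Ω → Fin d → ℝ) : Fin (T + 1) → Ω → Fin d → ℝ :=
  fun t ω k => if nodePrice ℱ Z t ω j ≤ 0 then nodePrice ℱ R t ω k / nodePrice ℱ R t ω j
    else nodePrice ℱ Z t ω k / nodePrice ℱ Z t ω j

lemma nodePrice_congr_node (Z : Ω → Fin d → ℝ) {t : Fin (T + 1)} {ω ω' : Ω}
    (h : ω' ∈ node (ℱ t) ω) : nodePrice ℱ Z t ω' = nodePrice ℱ Z t ω :=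
  funext fun _ => nodeSum_congr_node _ h

lemma normalizedPrice_congr_node (Z R : Ω → Fin d → ℝ) {t : Fin (T + 1)} {ω ω' : Ω}
    (h : ω' ∈ node (ℱ t) ω) :
    normalizedPrice ℱ j Z R t ω' = normalizedPrice ℱ j Z R t ω := by
  funext k
  simp only [normalizedPrice, nodePrice_congr_node _ h]

lemma nodePrice_pos_of_pos {R : Ω → Fin d → ℝ} (hRj : ∀ ω, 0 < R ω j) (t : Fin (T + 1)) (ω : Ω) :
    0 < nodePrice ℱ R t ω j := by
  classical
  refine Finset.sum_pos' (fun ω' _ => ?_) ⟨ω, Finset.mem_univ _, ?_⟩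
  · split_ifs
    exacts [(hRj ω').le, le_rfl]
  · simpa using hRj ω

lemma nodePrice_mul_normalizedPrice {Z R : Ω → Fin d → ℝ} (hZ : Z ∈ weightedPrices ℱ rate)
    (t : Fin (T + 1)) (ω : Ω) (k : Fin d) :
    nodePrice ℱ Z t ω j * normalizedPrice ℱ j Z R t ω k = nodePrice ℱ Z t ω k := by
  unfold normalizedPrice
  split_ifs with h
  · have h0 := le_antisymm h ((hZ t ω).1 j)
    rw [h0, eq_zero_of_mem_priceCone (hZ t ω) h0]
    simp
  · rw [mul_div_cancel₀ _ (not_le.1 h).ne']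

variable [MeasurableSingletonClass Ω]

lemma setIntegral_apply_eq_sum (Q : Measure Ω) [IsFiniteMeasure Q] (f : Ω → Fin d → ℝ)
    (A : Set Ω) (k : Fin d) :
    (∫ ω in A, f ω ∂Q) k = ∑ ω, (Q.real {ω} * f ω k) * A.indicator 1 ω := by
  rw [← integral_indicator (Set.toFinite A).measurableSet, integral_fintype .of_finite,
    Finset.sum_apply]
  refine Finset.sum_congr rfl fun ω _ => ?_
  by_cases h : ω ∈ A <;> simp [h]

lemma nodeSum_eq_setIntegral_apply (Q : Measure Ω) [IsFiniteMeasure Q] (f : Ω → Fin d → ℝ)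
    (t : Fin (T + 1)) (ω : Ω) (k : Fin d) :
    nodeSum (ℱ t) (fun ω' => Q.real {ω'} * f ω' k) ω = (∫ ω' in node (ℱ t) ω, f ω' ∂Q) k := by
  classical
  rw [setIntegral_apply_eq_sum]
  refine Finset.sum_congr rfl fun ω' _ => ?_
  by_cases h : ω' ∈ node (ℱ t) ω <;> simp [h]

/-- The martingale property in terms of sums over nodes. -/
lemma nodeSum_mul_eq_of_martingale {Q : Measure Ω} [IsFiniteMeasure Q]
    {S : Fin (T + 1) → Ω → Fin d → ℝ} (hS : Martingale S ℱ Q) (t : Fin (T + 1)) (ω : Ω)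
    (k : Fin d) :
    nodeSum (ℱ t) (fun ω' => Q.real {ω'} * S t ω' k) ω =
      nodePrice ℱ (pairWeights (Q, S)) t ω k := by
  rw [nodeSum_eq_setIntegral_apply, hS.setIntegral_eq (Fin.le_last t) (measurableSet_node _ _),
    ← nodeSum_eq_setIntegral_apply]
  rfl

lemma pairWeights_mem (hr : IsExchangeRates ℱ rate)
    {q : Measure Ω × (Fin (T + 1) → Ω → Fin d → ℝ)}
    (hq : q ∈ pricingPairsIn P ℱ rate j) :
    pairWeights q ∈ weightedPrices ℱ rate ∧ ∑ ω, pairWeights q ω j = 1 := by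
  obtain ⟨⟨hQ, -, hS, hcone⟩, hj⟩ := hq
  refine ⟨fun t ω => ?_, ?_⟩
  · have h1 : nodePrice ℱ (pairWeights q) t ω =
        nodeSum (ℱ t) (fun ω' => q.1.real {ω'}) ω • q.2 t ω := by
      funext k
      rw [← nodeSum_mul_eq_of_martingale hS]
      exact nodeSum_mul_right _ (fun ω ω' h => by rw [hS.apply_congr_node t ω ω' h]) ω
    rw [h1]
    have h2 := (hcone t ω).1
    rw [dualCone_nodeSet_solvencyCone hr] at h2
    refine smul_mem_priceCone h2 (Finset.sum_nonneg fun ω' _ => ?_)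
    split_ifs
    exacts [measureReal_nonneg, le_rfl]
  · simp only [pairWeights, hj, mul_one]
    rw [sum_measureReal_singleton, Finset.coe_univ, probReal_univ]

/-- The expected payoff only depends on the weighted prices. -/
lemma expectedPayoff_eq_pairing {ξ : Fin (T + 1) → Ω → Fin d → ℝ}
    (hξ : ∀ t, Measurable[ℱ t] (ξ t)) {χ : Fin (T + 1) → Ω → ℝ}
    (hχ : χ ∈ mixedStoppingTimes ℱ) {q : Measure Ω × (Fin (T + 1) → Ω → Fin d → ℝ)}
    (hq : q ∈ pricingPairsIn P ℱ rate j) :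
    expectedPayoff ξ χ q = pairing (pairWeights q) (mixedPayoff ξ χ) := by
  obtain ⟨⟨hQ, -, hS, -⟩, -⟩ := hq
  have h1 : ∀ t k, ∑ ω, q.1.real {ω} * q.2 t ω k * (χ t ω * ξ t ω k) =
      ∑ ω, pairWeights q ω k * (χ t ω * ξ t ω k) := fun t k =>
    sum_mul_congr_of_nodeSum_eq (m := ℱ t) (fun ω => nodeSum_mul_eq_of_martingale hS t ω k)
      fun ω ω' h => by
        rw [measurable_iff_forall_mem_node.1 (hξ t) ω ω' h,
          measurable_iff_forall_mem_node.1 (hχ.1 t) ω ω' h]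
  calc expectedPayoff ξ χ q
      = ∑ t, ∑ k, ∑ ω, q.1.real {ω} * q.2 t ω k * (χ t ω * ξ t ω k) := by
        rw [expectedPayoff, integral_fintype .of_finite]
        simp only [evalAt, dotProduct, smul_eq_mul, Finset.mul_sum]
        rw [Finset.sum_comm]
        refine Finset.sum_congr rfl fun t _ => ?_
        rw [Finset.sum_comm]
        exact Finset.sum_congr rfl fun k _ => Finset.sum_congr rfl fun ω _ => by ring
    _ = ∑ t, ∑ k, ∑ ω, pairWeights q ω k * (χ t ω * ξ t ω k) := by simp only [h1]
    _ = pairing (pairWeights q) (mixedPayoff ξ χ) := by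
        rw [pairing_eq_sum_coord, Finset.sum_comm]
        refine Finset.sum_congr rfl fun k _ => ?_
        rw [Finset.sum_comm]
        refine Finset.sum_congr rfl fun ω _ => ?_
        simp [mixedPayoff, Finset.mul_sum]

/-- Weighted prices whose weights sum to one in asset `j` come from a pricing pair. -/
lemma exists_mem_pricingPairsIn (hr : IsExchangeRates ℱ rate) (h_last : ℱ (Fin.last T) = ⊤)
    (hP : ∀ ω, 0 < P {ω}) {Z R : Ω → Fin d → ℝ} (hZ : Z ∈ weightedPrices ℱ rate)
    (hZj : ∑ ω, Z ω j = 1) (hR : R ∈ weightedPrices ℱ rate) (hRj : ∀ ω, 0 < R ω j) :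
    ∃ Q : Measure Ω, (Q, normalizedPrice ℱ j Z R) ∈ pricingPairsIn P ℱ rate j ∧
      (∀ ω, Q.real {ω} = Z ω j) ∧ pairWeights (Q, normalizedPrice ℱ j Z R) = Z := by
  have hlast : ∀ ω k, nodePrice ℱ Z (Fin.last T) ω k = Z ω k := by
    intro ω k
    rw [nodePrice, h_last, nodeSum_top]
  have hZ0 : ∀ ω, 0 ≤ Z ω j := fun ω => hlast ω j ▸ (hZ (Fin.last T) ω).1 j
  have hone : ∑ ω, ENNReal.ofReal (Z ω j) = 1 := by
    rw [← ENNReal.ofReal_sum_of_nonneg fun ω _ => hZ0 ω, hZj, ENNReal.ofReal_one]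
  let Q : Measure Ω := (PMF.ofFintype (fun ω => ENNReal.ofReal (Z ω j)) hone).toMeasure
  have hQ : ∀ ω, Q.real {ω} = Z ω j := by
    intro ω
    rw [measureReal_def, PMF.toMeasure_apply_singleton _ _ (measurableSet_singleton ω),
      PMF.ofFintype_apply, ENNReal.toReal_ofReal (hZ0 ω)]
  set S := normalizedPrice ℱ j Z R with hS
  have hRpos := nodePrice_pos_of_pos (ℱ := ℱ) hRj
  have hSj : ∀ t ω, S t ω j = 1 := by
    intro t ω
    simp only [hS, normalizedPrice]
    split_ifs with h
    · exact div_self (hRpos t ω).ne'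
    · exact div_self (not_le.1 h).ne'
  have hmeas : ∀ t, Measurable[ℱ t] (S t) := fun t =>
    measurable_iff_forall_mem_node.2 fun ω ω' h => normalizedPrice_congr_node Z R h
  have hint : ∀ t (A : Set Ω), MeasurableSet[ℱ t] A → ∀ k,
      (∫ ω in A, S t ω ∂Q) k = ∑ ω, Z ω k * A.indicator 1 ω := by
    intro t A hA k
    rw [setIntegral_apply_eq_sum]
    refine sum_mul_congr_of_nodeSum_eq (m := ℱ t) (fun ω => ?_) fun ω ω' h => ?_
    · simp only [hQ]
      rw [nodeSum_mul_right _ fun ω ω' h => by rw [hS, normalizedPrice_congr_node Z R h]]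
      exact nodePrice_mul_normalizedPrice hZ t ω k
    · have h1 : Measurable[ℱ t] (A.indicator (1 : Ω → ℝ)) :=
        (@measurable_const ℝ Ω _ (ℱ t) 1).indicator hA
      exact measurable_iff_forall_mem_node.1 h1 ω ω' h
  refine ⟨Q, ⟨⟨inferInstance, ?_, ⟨fun t => ?_, fun s t hst => ?_⟩, fun t ω => ⟨?_, ?_⟩⟩, hSj⟩,
    hQ, ?_⟩
  · intro A hA
    have : A = ∅ := by
      rw [Set.eq_empty_iff_forall_notMem]
      intro ω hω
      exact (hP ω).ne' (measure_mono_null (Set.singleton_subset_iff.2 hω) hA)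
    rw [this, measure_empty]
  · exact (hmeas t).stronglyMeasurable
  · refine (ae_eq_condExp_of_forall_setIntegral_eq (ℱ.le s) .of_finite
      (fun _ _ _ => Integrable.of_finite.integrableOn) (fun A hA _ => ?_)
      (hmeas s).stronglyMeasurable.aestronglyMeasurable).symm
    funext k
    rw [hint s A hA, hint t A (ℱ.mono hst A hA)]
  · rw [dualCone_nodeSet_solvencyCone hr]
    rcases le_or_gt (nodePrice ℱ Z t ω j) 0 with h | h
    · convert smul_mem_priceCone (hR t ω) (inv_nonneg.2 (hRpos t ω).le) using 1
      funext k
      simp [hS, normalizedPrice, h, div_eq_inv_mul]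
    · convert smul_mem_priceCone (hZ t ω) (inv_nonneg.2 h.le) using 1
      funext k
      simp [hS, normalizedPrice, not_le.2 h, div_eq_inv_mul]
  · intro h0
    have := hSj t ω
    rw [show S t ω = 0 from h0] at this
    exact zero_ne_one this
  · funext ω k
    rw [pairWeights, hQ, ← hlast ω j, ← hlast ω k]
    exact nodePrice_mul_normalizedPrice hZ _ ω k

/-- The weighted prices of the pricing pairs in asset `j`. -/
def normalizedWeightedPrices (ℱ : Filtration (Fin (T + 1)) mΩ)
    (rate : Fin (T + 1) → Fin d → Fin d → Ω → ℝ) (j : Fin d) : Set (Ω → Fin d → ℝ) :=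
  {Z | Z ∈ weightedPrices ℱ rate ∧ ∑ ω, Z ω j = 1}

lemma image_expectedPayoff (hr : IsExchangeRates ℱ rate) (h_last : ℱ (Fin.last T) = ⊤)
    (hP : ∀ ω, 0 < P {ω}) {R : Ω → Fin d → ℝ} (hR : R ∈ weightedPrices ℱ rate)
    (hRj : ∀ ω, 0 < R ω j) {ξ : Fin (T + 1) → Ω → Fin d → ℝ}
    (hξ : ∀ t, Measurable[ℱ t] (ξ t)) {χ : Fin (T + 1) → Ω → ℝ}
    (hχ : χ ∈ mixedStoppingTimes ℱ) :
    expectedPayoff ξ χ '' pricingPairsIn P ℱ rate j =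
      (fun Z => pairing Z (mixedPayoff ξ χ)) '' normalizedWeightedPrices ℱ rate j := by
  ext r
  constructor
  · rintro ⟨q, hq, rfl⟩
    exact ⟨_, pairWeights_mem hr hq, (expectedPayoff_eq_pairing hξ hχ hq).symm⟩
  · rintro ⟨Z, hZ, rfl⟩
    obtain ⟨Q, hQ, -, hQZ⟩ := exists_mem_pricingPairsIn hr h_last hP hZ.1 hZ.2 hR hRj
    exact ⟨_, hQ, by rw [expectedPayoff_eq_pairing hξ hχ hQ, hQZ]⟩

end PricingPairs

/-! ### The bid price as the value of a polyhedral game -/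

section BidPrice

variable {Ω : Type*} [Fintype Ω] {T d : ℕ}

lemma continuous_pairing_mixedPayoff (ξ : Fin (T + 1) → Ω → Fin d → ℝ) :
    Continuous fun p : (Fin (T + 1) → Ω → ℝ) × (Ω → Fin d → ℝ) =>
      pairing p.2 (mixedPayoff ξ p.1) := by
  simp only [pairing, mixedPayoff, dotProduct, Finset.sum_apply, Pi.smul_apply, smul_eq_mul]
  fun_prop

variable [mΩ : MeasurableSpace Ω]
  {ℱ : Filtration (Fin (T + 1)) mΩ} {rate : Fin (T + 1) → Fin d → Fin d → Ω → ℝ} {j : Fin d}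

/-- The absence of arbitrage yields weighted prices which are positive in every state: otherwise,
by Farkas' lemma, one unit of asset `j` in some state could be extracted for free. -/
lemma NoArbitrage.exists_weightedPrices_pos (hr : IsExchangeRates ℱ rate)
    (hna : NoArbitrage ℱ rate) (h_last : ℱ (Fin.last T) = ⊤) (j : Fin d) :
    ∃ R ∈ weightedPrices ℱ rate, ∀ ω, 0 < R ω j := by
  classical
  have hex : ∀ ω, ∃ Z ∈ weightedPrices ℱ rate, 0 < Z ω j := by
    intro ω
    by_contra! hcon
    let x : Ω → Fin d → ℝ := Pi.single ω (Pi.single j 1)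
    have hx : ∀ Z, pairing Z x = Z ω j := by
      intro Z
      rw [pairing, Finset.sum_eq_single ω]
      · simp [x]
      · intro ω' _ hω'
        simp [x, hω']
      · simp
    obtain ⟨c, hc, hsum⟩ := exists_generator_combination (ℱ := ℱ) (rate := rate) (-x)
      fun Z hZ => by
        rw [pairing_neg_right, hx]
        exact neg_nonneg.2 (hcon Z hZ)
    obtain ⟨k, hk, hk'⟩ := exists_solvent_sum_of_generator_combination hr hc
    refine hna.neg_ne_sum h_last (x := x) ?_ ?_ hk (hsum.trans hk')
    · intro h0
      have := congrFun (congrFun h0 ω) j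
      simp [x] at this
    · have : (0 : Ω → Fin d → ℝ) ≤ x := Pi.single_nonneg.2 (Pi.single_nonneg.2 zero_le_one)
      exact fun ω' k => this ω' k
  choose Z hZ hZpos using hex
  refine ⟨∑ ω, Z ω, Finset.sum_induction _ (· ∈ weightedPrices ℱ rate)
    (fun _ _ => add_mem_weightedPrices) zero_mem_weightedPrices fun ω _ => hZ ω, fun ω => ?_⟩
  rw [Finset.sum_apply, Finset.sum_apply]
  refine Finset.sum_pos' (fun ω' _ => ?_) ⟨ω, Finset.mem_univ _, hZpos ω⟩
  have := (hZ ω' (Fin.last T) ω).1 j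
  rwa [nodePrice, h_last, nodeSum_top] at this

lemma continuous_nodePrice (t : Fin (T + 1)) (ω : Ω) (k : Fin d) :
    Continuous fun Z => nodePrice ℱ Z t ω k := by
  classical
  unfold nodePrice nodeSum
  refine continuous_finsetSum _ fun ω' _ => ?_
  split_ifs <;> fun_prop

lemma isCompact_normalizedWeightedPrices (hr : IsExchangeRates ℱ rate)
    (h_last : ℱ (Fin.last T) = ⊤) :
    IsCompact (normalizedWeightedPrices ℱ rate j) := by
  refine (isCompact_Icc (a := (0 : Ω → Fin d → ℝ))
    (b := fun ω k => rate (Fin.last T) j k ω)).of_isClosed_subset ?_ ?_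
  · have : normalizedWeightedPrices ℱ rate j =
        (⋂ t, ⋂ ω, ((⋂ k, {Z | 0 ≤ nodePrice ℱ Z t ω k}) ∩
          ⋂ i, ⋂ k, {Z | nodePrice ℱ Z t ω k ≤ rate t i k ω * nodePrice ℱ Z t ω i})) ∩
        {Z | ∑ ω, Z ω j = 1} := by
      ext Z
      simp [normalizedWeightedPrices, weightedPrices, priceCone]
    rw [this]
    refine .inter (isClosed_iInter fun t => isClosed_iInter fun ω => .inter
      (isClosed_iInter fun k => ?_) (isClosed_iInter fun i => isClosed_iInter fun k => ?_)) ?_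
    · exact isClosed_le continuous_const (continuous_nodePrice t ω k)
    · exact isClosed_le (continuous_nodePrice t ω k)
        (continuous_const.mul (continuous_nodePrice t ω i))
    · exact isClosed_eq (by fun_prop) continuous_const
  · rintro Z ⟨hZ, hZj⟩
    have h1 : ∀ ω, (∀ k, 0 ≤ Z ω k) ∧ ∀ k, Z ω k ≤ rate (Fin.last T) j k ω * Z ω j := by
      intro ω
      have h := hZ (Fin.last T) ω
      have h0 : nodePrice ℱ Z (Fin.last T) ω = Z ω := by
        funext k
        rw [nodePrice, h_last, nodeSum_top]
      rw [h0] at h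
      exact ⟨h.1, h.2 j⟩
    refine ⟨fun ω k => (h1 ω).1 k, fun ω k => ((h1 ω).2 k).trans ?_⟩
    have h2 : Z ω j ≤ 1 := hZj ▸ Finset.single_le_sum (fun ω' _ => (h1 ω').1 j)
      (Finset.mem_univ ω)
    exact mul_le_of_le_one_right (hr.pos _ _ _ _).le h2

lemma normalizedWeightedPrices_nonempty {R : Ω → Fin d → ℝ} [Nonempty Ω]
    (hR : R ∈ weightedPrices ℱ rate) (hRj : ∀ ω, 0 < R ω j) :
    (normalizedWeightedPrices ℱ rate j).Nonempty := by
  have hpos : 0 < ∑ ω, R ω j := Finset.sum_pos (fun ω _ => hRj ω) Finset.univ_nonempty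
  refine ⟨(∑ ω, R ω j)⁻¹ • R, smul_mem_weightedPrices hR (inv_nonneg.2 hpos.le), ?_⟩
  simp only [Pi.smul_apply, smul_eq_mul, ← Finset.mul_sum]
  exact inv_mul_cancel₀ hpos.ne'

/-- A portfolio consisting of `x` units of asset `j` and of `u` has a non-negative value under all
weighted prices if and only if `-x` is at most the value of `u` under the normalized ones. -/
lemma forall_pairing_nonneg_iff (h_last : ℱ (Fin.last T) = ⊤) (x : ℝ) (u : Ω → Fin d → ℝ) :
    (∀ Z ∈ weightedPrices ℱ rate,
        0 ≤ pairing Z ((fun _ => x • (Pi.single j 1 : Fin d → ℝ)) + u)) ↔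
      ∀ Z ∈ normalizedWeightedPrices ℱ rate j, -x ≤ pairing Z u := by
  have h0 : ∀ Z : Ω → Fin d → ℝ,
      pairing Z (fun _ => x • (Pi.single j 1 : Fin d → ℝ)) = x * ∑ ω, Z ω j := by
    intro Z
    simp [pairing, Finset.mul_sum]
  simp only [pairing_add_right, h0]
  constructor
  · rintro h Z ⟨hZ, hZj⟩
    have := h Z hZ
    rw [hZj] at this
    linarith
  · intro h Z hZ
    have hZ' : ∀ ω, Z ω ∈ priceCone rate (Fin.last T) ω := by
      intro ω
      have h1 : nodePrice ℱ Z (Fin.last T) ω = Z ω := by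
        funext k
        rw [nodePrice, h_last, nodeSum_top]
      exact h1 ▸ hZ (Fin.last T) ω
    rcases (Finset.sum_nonneg fun ω (_ : ω ∈ Finset.univ) => (hZ' ω).1 j).eq_or_lt with hs | hs
    · have h1 : Z = 0 := by
        funext ω
        exact eq_zero_of_mem_priceCone (hZ' ω)
          ((Finset.sum_eq_zero_iff_of_nonneg fun ω _ => (hZ' ω).1 j).1 hs.symm ω
            (Finset.mem_univ ω))
      simp [h1, pairing]
    · have h1 := h ((∑ ω, Z ω j)⁻¹ • Z) ⟨smul_mem_weightedPrices hZ (inv_nonneg.2 hs.le), by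
        simp only [Pi.smul_apply, smul_eq_mul, ← Finset.mul_sum]
        exact inv_mul_cancel₀ hs.ne'⟩
      rw [pairing_smul_left, ← div_eq_inv_mul, le_div_iff₀ hs] at h1
      linarith

/-- The duality of hedging, with the hedging condition in terms of the generators of the solvency
cones. -/
lemma exists_generator_combination_iff (hr : IsExchangeRates ℱ rate)
    (h_last : ℱ (Fin.last T) = ⊤) (x : ℝ) (u : Ω → Fin d → ℝ) :
    (∃ c : GeneratorIndex Ω T d → ℝ, (∀ a, 0 ≤ c a) ∧
        (fun _ => x • (Pi.single j 1 : Fin d → ℝ)) + u = ∑ a, c a • generator ℱ rate a) ↔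
      ∀ Z ∈ normalizedWeightedPrices ℱ rate j, -x ≤ pairing Z u := by
  rw [← forall_pairing_nonneg_iff h_last]
  constructor
  · rintro ⟨c, hc, h⟩ Z hZ
    obtain ⟨k, hk, hk'⟩ := exists_solvent_sum_of_generator_combination hr hc
    rw [h, hk']
    exact pairing_nonneg_of_eq_sum hr hk hZ
  · exact exists_generator_combination _

/-- The duality of hedging for a fixed mixed stopping time. -/
lemma exists_buyerStrategy_iff_forall_le (hr : IsExchangeRates ℱ rate)
    (h_last : ℱ (Fin.last T) = ⊤) {ξ : Fin (T + 1) → Ω → Fin d → ℝ}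
    (hξ : ∀ t, Measurable[ℱ t] (ξ t)) {χ : Fin (T + 1) → Ω → ℝ}
    (hχ : χ ∈ mixedStoppingTimes ℱ) (x : ℝ) :
    (∃ y, (y, χ) ∈ buyerStrategies ℱ rate ξ ∧
        ∀ ω, y 0 ω = x • (Pi.single j 1 : Fin d → ℝ)) ↔
      ∀ Z ∈ normalizedWeightedPrices ℱ rate j, -x ≤ pairing Z (mixedPayoff ξ χ) := by
  rw [exists_buyerStrategy_iff hξ hχ]
  constructor
  · rintro ⟨k, hk, h⟩
    refine (forall_pairing_nonneg_iff h_last x _).1 fun Z hZ => ?_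
    rw [h]
    exact pairing_nonneg_of_eq_sum hr hk hZ
  · intro h
    obtain ⟨c, hc, hsum⟩ := (exists_generator_combination_iff hr h_last x _).2 h
    obtain ⟨k, hk, hk'⟩ := exists_solvent_sum_of_generator_combination hr hc
    exact ⟨k, hk, hsum.trans hk'⟩

/-- The least value of the mixed payoff under the normalized weighted prices. -/
noncomputable def worstValue (ℱ : Filtration (Fin (T + 1)) mΩ)
    (rate : Fin (T + 1) → Fin d → Fin d → Ω → ℝ) (j : Fin d)
    (ξ : Fin (T + 1) → Ω → Fin d → ℝ) (χ : Fin (T + 1) → Ω → ℝ) : ℝ :=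
  sInf ((fun Z => pairing Z (mixedPayoff ξ χ)) '' normalizedWeightedPrices ℱ rate j)

lemma isLeast_worstValue (hr : IsExchangeRates ℱ rate) (h_last : ℱ (Fin.last T) = ⊤)
    (hne : (normalizedWeightedPrices ℱ rate j).Nonempty) (ξ : Fin (T + 1) → Ω → Fin d → ℝ)
    (χ : Fin (T + 1) → Ω → ℝ) :
    IsLeast ((fun Z => pairing Z (mixedPayoff ξ χ)) '' normalizedWeightedPrices ℱ rate j)
      (worstValue ℱ rate j ξ χ) := by
  refine ((isCompact_normalizedWeightedPrices hr h_last).image ?_).isLeast_sInf (hne.image _)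
  exact (continuous_pairing_mixedPayoff ξ).comp (by fun_prop : Continuous fun Z => (χ, Z))

lemma isCompact_mixedStoppingTimes : IsCompact (mixedStoppingTimes ℱ) := by
  refine (isCompact_Icc (a := (0 : Fin (T + 1) → Ω → ℝ)) (b := 1)).of_isClosed_subset ?_
    fun χ hχ => ⟨fun t ω => (hχ.2.1 t ω).1, fun t ω => (hχ.2.1 t ω).2⟩
  have : mixedStoppingTimes ℱ = (⋂ t, ⋂ ω, ⋂ ω', ⋂ (_ : ω' ∈ node (ℱ t) ω),
      {χ : Fin (T + 1) → Ω → ℝ | χ t ω' = χ t ω}) ∩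
      ((⋂ t, ⋂ ω, {χ | χ t ω ∈ Set.Icc (0 : ℝ) 1}) ∩ ⋂ ω, {χ | ∑ t, χ t ω = 1}) := by
    ext χ
    simp only [mixedStoppingTimes, measurable_iff_forall_mem_node]
    simp
  rw [this]
  refine .inter (isClosed_iInter fun t => isClosed_iInter fun ω => isClosed_iInter fun ω' =>
    isClosed_iInter fun _ => isClosed_eq (by fun_prop) (by fun_prop)) (.inter
    (isClosed_iInter fun t => isClosed_iInter fun ω => isClosed_Icc.preimage (by fun_prop))
    (isClosed_iInter fun ω => isClosed_eq (by fun_prop) continuous_const))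

lemma mixedStoppingTimes_nonempty : (mixedStoppingTimes ℱ).Nonempty := by
  classical
  refine ⟨fun t _ => if t = 0 then 1 else 0, fun t => ?_, fun t ω => ?_, fun ω => ?_⟩
  · exact measurable_iff_forall_mem_node.2 fun _ _ _ => rfl
  · dsimp only
    split_ifs <;> simp
  · simp

lemma exists_isMaxOn_worstValue (hr : IsExchangeRates ℱ rate) (h_last : ℱ (Fin.last T) = ⊤)
    (ξ : Fin (T + 1) → Ω → Fin d → ℝ) :
    ∃ χ ∈ mixedStoppingTimes ℱ, IsMaxOn (worstValue ℱ rate j ξ) (mixedStoppingTimes ℱ) χ :=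
  isCompact_mixedStoppingTimes.exists_isMaxOn mixedStoppingTimes_nonempty
    ((isCompact_normalizedWeightedPrices hr h_last).continuous_sInf
      (continuous_pairing_mixedPayoff ξ)).continuousOn

/-- The bid price is the value of the game in which the buyer chooses a mixed stopping time and
the opponent chooses weighted prices. -/
lemma bidPrice_eq_worstValue (hr : IsExchangeRates ℱ rate)
    (h_last : ℱ (Fin.last T) = ⊤) (hne : (normalizedWeightedPrices ℱ rate j).Nonempty)
    {ξ : Fin (T + 1) → Ω → Fin d → ℝ} (hξ : ∀ t, Measurable[ℱ t] (ξ t))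
    {χ : Fin (T + 1) → Ω → ℝ} (hχ : χ ∈ mixedStoppingTimes ℱ)
    (hmax : IsMaxOn (worstValue ℱ rate j ξ) (mixedStoppingTimes ℱ) χ) :
    bidPrice ℱ rate ξ j = (worstValue ℱ rate j ξ χ : EReal) := by
  refine IsGreatest.csSup_eq ⟨⟨-worstValue ℱ rate j ξ χ, by simp, ?_⟩, ?_⟩
  · obtain ⟨y, hy, hy0⟩ := (exists_buyerStrategy_iff_forall_le (j := j) hr h_last hξ hχ
      (-worstValue ℱ rate j ξ χ)).2 fun Z hZ => by
        rw [neg_neg]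
        exact (isLeast_worstValue hr h_last hne ξ χ).2 ⟨Z, hZ, rfl⟩
    exact ⟨(y, χ), hy, hy0⟩
  · rintro _ ⟨x, rfl, ⟨y, χ'⟩, hp, hy0⟩
    have h1 := (exists_buyerStrategy_iff_forall_le hr h_last hξ hp.2.1 x).1 ⟨y, hp, hy0⟩
    obtain ⟨Z, hZ, hZv⟩ := (isLeast_worstValue hr h_last hne ξ χ').1
    refine EReal.coe_le_coe_iff.2 ((h1 Z hZ).trans ?_)
    exact hZv.le.trans (hmax hp.2.1)

end BidPrice

/-! ### Computation of optimisers -/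

section Optimisers

variable {Ω : Type*} [mΩ : MeasurableSpace Ω] {T d : ℕ}

/-- The exchange rates which are encoded by the inputs `v`. -/
def inputRate (v : InputIndex Ω T d → ℝ) : Fin (T + 1) → Fin d → Fin d → Ω → ℝ :=
  fun t i k ω => v (.inl (t, i, k, ω))

/-- The payoff process which is encoded by the inputs `v`. -/
def inputPayoff (v : InputIndex Ω T d → ℝ) : Fin (T + 1) → Ω → Fin d → ℝ :=
  fun t ω k => v (.inr (t, k, ω))

variable (ℱ : Filtration (Fin (T + 1)) mΩ) (j : Fin d)

lemma isComputable_generator (a : GeneratorIndex Ω T d) (ω : Ω) (l : Fin d) :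
    IsComputable fun v => generator ℱ (inputRate v) a ω l := by
  obtain ⟨t, ω₀, k | ⟨i, k⟩⟩ := a <;> simp only [generator]
  · exact (isComputable_one.const_ite _ isComputable_zero).const_ite _ isComputable_zero
  · exact (((isComputable_input _).const_ite _ isComputable_zero).sub
      (isComputable_one.const_ite _ isComputable_zero)).const_ite _ isComputable_zero

variable [Fintype Ω]

lemma isComputable_nodePrice {ι : Type*} {Z : (ι → ℝ) → Ω → Fin d → ℝ}
    (hZ : ∀ ω k, IsComputable fun v => Z v ω k) (t : Fin (T + 1)) (ω : Ω) (k : Fin d) :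
    IsComputable fun v => nodePrice ℱ (Z v) t ω k :=
  .sum _ fun ω' => (hZ ω' k).const_ite _ isComputable_zero

lemma isComputable_normalizedPrice {ι : Type*} {Z R : (ι → ℝ) → Ω → Fin d → ℝ}
    (hZ : ∀ ω k, IsComputable fun v => Z v ω k) (hR : ∀ ω k, IsComputable fun v => R v ω k)
    (t : Fin (T + 1)) (ω : Ω) (k : Fin d) :
    IsComputable fun v => normalizedPrice ℱ j (Z v) (R v) t ω k :=
  (IsTestable.le (isComputable_nodePrice ℱ hZ t ω j) isComputable_zero).ite
    ((isComputable_nodePrice ℱ hR t ω k).div (isComputable_nodePrice ℱ hR t ω j))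
    ((isComputable_nodePrice ℱ hZ t ω k).div (isComputable_nodePrice ℱ hZ t ω j))

lemma isParamAffine_nodePrice {ι : Type*} (t : Fin (T + 1)) (ω : Ω) (k : Fin d) :
    IsParamAffine fun (_ : ι → ℝ) (x : Ω × Fin d → ℝ) =>
      nodePrice ℱ (fun ω k => x (ω, k)) t ω k :=
  .sum _ fun ω' => (isParamAffine_unknown (ω', k)).const_ite _ isComputable_zero.isParamAffine

lemma isParamPolyhedron_weightedPrices :
    IsParamPolyhedron fun (v : InputIndex Ω T d → ℝ) (x : Ω × Fin d → ℝ) =>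
      (fun ω k => x (ω, k)) ∈ weightedPrices ℱ (inputRate v) :=
  .all fun t => .all fun ω => .and
    (.all fun k => .le isComputable_zero.isParamAffine (isParamAffine_nodePrice ℱ t ω k))
    (.all fun i => .all fun k => .le (isParamAffine_nodePrice ℱ t ω k)
      ((isParamAffine_nodePrice ℱ t ω i).const_mul (isComputable_input _)))

/-- Positive weighted prices can be computed: up to scaling they are the solutions of a system of
linear inequalities. -/
lemma exists_computable_positive_weightedPrices :
    ∃ R : (InputIndex Ω T d → ℝ) → Ω → Fin d → ℝ, (∀ ω k, IsComputable fun v => R v ω k) ∧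
      ∀ v, (∃ R' ∈ weightedPrices ℱ (inputRate v), ∀ ω, 0 < R' ω j) →
        R v ∈ weightedPrices ℱ (inputRate v) ∧ ∀ ω, 0 < R v ω j := by
  obtain ⟨x, hx, hopt⟩ := ((isParamPolyhedron_weightedPrices ℱ).and
    (.all fun ω => .le isComputable_one.isParamAffine
      (isParamAffine_unknown (ω, j)))).exists_computable_maximizer isComputable_zero.isParamAffine
  refine ⟨fun v ω k => x v (ω, k), fun ω k => hx _, fun v ⟨R', hR', hpos⟩ => ?_⟩
  have hc : ∀ ω ∈ Finset.univ, 0 ≤ (R' ω j)⁻¹ := fun ω _ => inv_nonneg.2 (hpos ω).le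
  obtain ⟨⟨h1, h2⟩, -⟩ := hopt v (fun p => ((∑ ω, (R' ω j)⁻¹) • R') p.1 p.2)
    ⟨smul_mem_weightedPrices hR' (Finset.sum_nonneg hc), fun ω => by
      have h3 : (R' ω j)⁻¹ ≤ ∑ ω, (R' ω j)⁻¹ := Finset.single_le_sum hc (Finset.mem_univ ω)
      have h4 := mul_le_mul_of_nonneg_right h3 (hpos ω).le
      rwa [inv_mul_cancel₀ (hpos ω).ne'] at h4⟩ fun _ _ => le_rfl
  exact ⟨h1, fun ω => zero_lt_one.trans_le (h2 ω)⟩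

/-- Optimal weighted prices against a computable mixed stopping time can be computed. -/
lemma exists_computable_optimal_weightedPrices
    {χ : (InputIndex Ω T d → ℝ) → Fin (T + 1) → Ω → ℝ}
    (hχ : ∀ t ω, IsComputable fun v => χ v t ω) (h_last : ℱ (Fin.last T) = ⊤) :
    ∃ Z : (InputIndex Ω T d → ℝ) → Ω → Fin d → ℝ, (∀ ω k, IsComputable fun v => Z v ω k) ∧
      ∀ v, IsExchangeRates ℱ (inputRate v) →
        (normalizedWeightedPrices ℱ (inputRate v) j).Nonempty →
        Z v ∈ normalizedWeightedPrices ℱ (inputRate v) j ∧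
        pairing (Z v) (mixedPayoff (inputPayoff v) (χ v)) =
          worstValue ℱ (inputRate v) j (inputPayoff v) (χ v) := by
  have hg : IsParamAffine fun (v : InputIndex Ω T d → ℝ) (x : Ω × Fin d → ℝ) =>
      - pairing (fun ω k => x (ω, k)) (mixedPayoff (inputPayoff v) (χ v)) := by
    simp only [pairing, dotProduct, mixedPayoff, Finset.sum_apply, Pi.smul_apply, smul_eq_mul]
    exact (IsParamAffine.sum _ fun ω => .sum _ fun k => (isParamAffine_unknown _).mul_const
      (.sum _ fun t => (hχ t ω).mul (isComputable_input _))).neg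
  obtain ⟨x, hx, hopt⟩ := ((isParamPolyhedron_weightedPrices ℱ).and
    (.eq (.sum Finset.univ fun ω => isParamAffine_unknown (ω, j))
      isComputable_one.isParamAffine)).exists_computable_maximizer hg
  refine ⟨fun v ω k => x v (ω, k), fun ω k => hx _, fun v hr hne => ?_⟩
  have hleast := isLeast_worstValue hr h_last hne (inputPayoff v) (χ v)
  obtain ⟨Z, hZ, hZv⟩ := hleast.1
  dsimp only at hZv
  obtain ⟨h1, h2⟩ := hopt v (fun p => Z p.1 p.2) hZ fun z hz => by
    rw [neg_le_neg_iff, hZv]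
    exact hleast.2 ⟨_, hz, rfl⟩
  rw [neg_le_neg_iff, hZv] at h2
  exact ⟨h1, le_antisymm h2 (hleast.2 ⟨_, h1, rfl⟩)⟩

/-- An optimal mixed stopping time can be computed: together with the superhedging price and with
coefficients of the generators of the solvency cones, it solves a linear program. -/
lemma exists_computable_optimal_mixedStoppingTime (h_last : ℱ (Fin.last T) = ⊤) :
    ∃ χ : (InputIndex Ω T d → ℝ) → Fin (T + 1) → Ω → ℝ, (∀ t ω, IsComputable fun v => χ v t ω) ∧
      ∀ v, IsExchangeRates ℱ (inputRate v) →
        (normalizedWeightedPrices ℱ (inputRate v) j).Nonempty →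
        χ v ∈ mixedStoppingTimes ℱ ∧
        IsMaxOn (worstValue ℱ (inputRate v) j (inputPayoff v)) (mixedStoppingTimes ℱ) (χ v) := by
  -- the unknowns: the initial endowment, the mixed stopping time, and the coefficients
  let J := Option ((Fin (T + 1) × Ω) ⊕ GeneratorIndex Ω T d)
  let chi : (J → ℝ) → Fin (T + 1) → Ω → ℝ := fun x t ω => x (some (.inl (t, ω)))
  let coeff : (J → ℝ) → GeneratorIndex Ω T d → ℝ := fun x a => x (some (.inr a))
  have hchi : ∀ t ω, IsParamAffine fun (_ : InputIndex Ω T d → ℝ) x => chi x t ω :=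
    fun t ω => isParamAffine_unknown _
  have hcoeff : ∀ a, IsParamAffine fun (_ : InputIndex Ω T d → ℝ) x => coeff x a :=
    fun a => isParamAffine_unknown _
  have hp₁ : IsParamPolyhedron fun (_ : InputIndex Ω T d → ℝ) x =>
      chi x ∈ mixedStoppingTimes ℱ := by
    simp only [mixedStoppingTimes, Set.mem_ofPred_eq, measurable_iff_forall_mem_node, Set.mem_Icc]
    exact .and (.all fun t => .all fun ω => .all fun ω' => .const_imp
        (.eq (hchi t ω') (hchi t ω)))
      (.and (.all fun t => .all fun ω => .and
          (.le isComputable_zero.isParamAffine (hchi t ω))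
          (.le (hchi t ω) isComputable_one.isParamAffine))
        (.all fun ω => .eq (.sum _ fun t => hchi t ω) isComputable_one.isParamAffine))
  have hp₂ : IsParamPolyhedron fun (_ : InputIndex Ω T d → ℝ) x => ∀ a, 0 ≤ coeff x a :=
    .all fun a => .le isComputable_zero.isParamAffine (hcoeff a)
  have hp₃ : IsParamPolyhedron fun (v : InputIndex Ω T d → ℝ) x =>
      (fun _ => x none • (Pi.single j 1 : Fin d → ℝ)) + mixedPayoff (inputPayoff v) (chi x) =
        ∑ a, coeff x a • generator ℱ (inputRate v) a := by
    simp only [funext_iff, Pi.add_apply, mixedPayoff, Finset.sum_apply, Pi.smul_apply,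
      smul_eq_mul, Pi.single_apply]
    exact .all fun ω => .all fun k => .eq
      (.add ((isParamAffine_unknown _).mul_const (isComputable_one.const_ite _ isComputable_zero))
        (.sum _ fun t => (hchi t ω).mul_const (isComputable_input _)))
      (.sum _ fun a => (hcoeff a).mul_const (isComputable_generator ℱ a ω k))
  obtain ⟨x, hx, hopt⟩ := (hp₁.and (hp₂.and hp₃)).exists_computable_maximizer
    (isParamAffine_unknown none).neg
  refine ⟨fun v => chi (x v), fun t ω => hx _, fun v hr hne => ?_⟩
  obtain ⟨χ, hχ, hmax⟩ := exists_isMaxOn_worstValue (j := j) hr h_last (inputPayoff v)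
  have hleast := isLeast_worstValue hr h_last hne (inputPayoff v)
  -- a solution of the constraints bounds the worst value of its mixed stopping time
  have hle : ∀ z, (chi z ∈ mixedStoppingTimes ℱ ∧ (∀ a, 0 ≤ coeff z a) ∧
      (fun _ => z none • (Pi.single j 1 : Fin d → ℝ)) + mixedPayoff (inputPayoff v) (chi z) =
        ∑ a, coeff z a • generator ℱ (inputRate v) a) →
      - z none ≤ worstValue ℱ (inputRate v) j (inputPayoff v) (chi z) := by
    rintro z ⟨-, hz0, hz⟩
    obtain ⟨Z, hZ, hZv⟩ := (hleast (chi z)).1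
    exact ((exists_generator_combination_iff hr h_last _ _).1 ⟨_, hz0, hz⟩ Z hZ).trans hZv.le
  obtain ⟨c, hc, hsum⟩ := (exists_generator_combination_iff (j := j) hr h_last
    (-worstValue ℱ (inputRate v) j (inputPayoff v) χ) (mixedPayoff (inputPayoff v) χ)).2
    fun Z hZ => by
      rw [neg_neg]
      exact (hleast χ).2 ⟨Z, hZ, rfl⟩
  obtain ⟨h1, h2⟩ := hopt v (fun i => i.elim (-worstValue ℱ (inputRate v) j (inputPayoff v) χ)
    (Sum.elim (fun p => χ p.1 p.2) c)) ⟨hχ, hc, hsum⟩ fun z hz => by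
      simp only [Option.elim, neg_neg]
      exact (hle z hz).trans (hmax hz.1)
  simp only [Option.elim, neg_neg] at h2
  exact ⟨h1.1, fun χ' hχ' => (hmax hχ').trans (h2.trans (hle _ h1))⟩

end Optimisers
end GradualExercise

theorem mainTheorem4 {Ω : Type*} [Finite Ω] [mΩ : MeasurableSpace Ω]
    (P : Measure Ω) [IsProbabilityMeasure P] (hP : ∀ ω, 0 < P {ω})
    {T d : ℕ} (ℱ : Filtration (Fin (T + 1)) mΩ)
    (h_first : ℱ 0 = ⊥) (h_last : ℱ (Fin.last T) = ⊤) (j : Fin d) :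
    -- the dual representation, with attained minima and an attained maximum
    (∀ (rate : Fin (T + 1) → Fin d → Fin d → Ω → ℝ) (ξ : Fin (T + 1) → Ω → Fin d → ℝ),
      IsExchangeRates ℱ rate → NoArbitrage ℱ rate → (∀ t, Measurable[ℱ t] (ξ t)) →
      (∀ χ ∈ mixedStoppingTimes ℱ,
        ∃ m : ℝ, IsLeast (expectedPayoff ξ χ '' pricingPairsIn P ℱ rate j) m) ∧
      ∃ v : ℝ, bidPrice ℱ rate ξ j = (v : EReal) ∧
        IsGreatest {m : ℝ | ∃ χ ∈ mixedStoppingTimes ℱ,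
          IsLeast (expectedPayoff ξ χ '' pricingPairsIn P ℱ rate j) m} v) ∧
    -- one algorithm computes optimisers from the exchange rates and the payoff
    ∃ A : RealAlgorithm (InputIndex Ω T d) (OutputIndex Ω T d),
      ∀ (rate : Fin (T + 1) → Fin d → Fin d → Ω → ℝ) (ξ : Fin (T + 1) → Ω → Fin d → ℝ),
        IsExchangeRates ℱ rate → NoArbitrage ℱ rate → (∀ t, Measurable[ℱ t] (ξ t)) →
        ∃ χ ∈ mixedStoppingTimes ℱ, ∃ q ∈ pricingPairsIn P ℱ rate j,
          A.run (encodeInput rate ξ) = encodeOutput χ q ∧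
          bidPrice ℱ rate ξ j = (expectedPayoff ξ χ q : EReal) ∧
          IsLeast (expectedPayoff ξ χ '' pricingPairsIn P ℱ rate j) (expectedPayoff ξ χ q) := by
  cases nonempty_fintype Ω
  have htop : mΩ = ⊤ := top_le_iff.1 (h_last ▸ ℱ.le _)
  have : MeasurableSingletonClass Ω := ⟨fun _ => htop ▸ trivial⟩
  have : Nonempty Ω := nonempty_of_isProbabilityMeasure P
  constructor
  · intro rate ξ hr hna hξ
    obtain ⟨R, hR, hRj⟩ := hna.exists_weightedPrices_pos hr h_last j
    have hne := normalizedWeightedPrices_nonempty hR hRj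
    have hleast : ∀ χ ∈ mixedStoppingTimes ℱ,
        IsLeast (expectedPayoff ξ χ '' pricingPairsIn P ℱ rate j)
          (worstValue ℱ rate j ξ χ) := fun χ hχ => by
      rw [image_expectedPayoff hr h_last hP hR hRj hξ hχ]
      exact isLeast_worstValue hr h_last hne ξ χ
    obtain ⟨χ, hχ, hmax⟩ := exists_isMaxOn_worstValue (j := j) hr h_last ξ
    refine ⟨fun χ hχ => ⟨_, hleast χ hχ⟩, _, bidPrice_eq_worstValue hr h_last hne hξ hχ hmax,
      ⟨χ, hχ, hleast χ hχ⟩, ?_⟩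
    rintro m ⟨χ', hχ', hm⟩
    rw [hm.unique (hleast χ' hχ')]
    exact hmax hχ'
  · obtain ⟨χ, hχ, hχopt⟩ := exists_computable_optimal_mixedStoppingTime ℱ j h_last
    obtain ⟨Z, hZ, hZopt⟩ := exists_computable_optimal_weightedPrices ℱ j hχ h_last
    obtain ⟨R, hR, hRpos⟩ := exists_computable_positive_weightedPrices ℱ j
    obtain ⟨A, hA⟩ := exists_algorithm (κ := OutputIndex Ω T d)
      (fun v => Sum.elim (fun p => χ v p.1 p.2) (Sum.elim (fun ω => Z v ω j)
        fun p => normalizedPrice ℱ j (Z v) (R v) p.1 p.2.2 p.2.1)) (by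
        rintro (⟨t, ω⟩ | ω | ⟨t, k, ω⟩)
        exacts [hχ t ω, hZ ω j, isComputable_normalizedPrice ℱ j hZ hR t ω k])
    refine ⟨A, fun rate ξ hr hna hξ => ?_⟩
    have hex := hna.exists_weightedPrices_pos hr h_last j
    obtain ⟨hRw, hRj⟩ := hRpos (encodeInput rate ξ) hex
    have hne := normalizedWeightedPrices_nonempty hRw hRj
    obtain ⟨hχm, hmax⟩ := hχopt (encodeInput rate ξ) hr hne
    obtain ⟨hZm, hZv⟩ := hZopt (encodeInput rate ξ) hr hne
    obtain ⟨Q, hq, hQ, hqZ⟩ := exists_mem_pricingPairsIn hr h_last hP hZm.1 hZm.2 hRw hRj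
    have hval : expectedPayoff ξ (χ (encodeInput rate ξ))
        (Q, normalizedPrice ℱ j (Z (encodeInput rate ξ)) (R (encodeInput rate ξ))) =
        worstValue ℱ rate j ξ (χ (encodeInput rate ξ)) := by
      rw [expectedPayoff_eq_pairing hξ hχm hq, hqZ]
      exact hZv
    refine ⟨_, hχm, _, hq, ?_, ?_, ?_⟩
    · rw [hA]
      funext i
      obtain ⟨t, ω⟩ | ω | ⟨t, k, ω⟩ := i
      exacts [rfl, (hQ ω).symm, rfl]
    · rw [hval]
      exact bidPrice_eq_worstValue hr h_last hne hξ hχm hmax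
    · rw [hval, image_expectedPayoff hr h_last hP hRw hRj hξ hχm]
      exact isLeast_worstValue hr h_last hne ξ _
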